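/- Let $\mathbb{H}^3$ be hyperbolic 3-space (the complete simply connected Riemannian 3-manifold of constant curvature $-1$), with pointwise norm $|\cdot|$ on cotangent vectors induced by the metric, and volume form $d\mathrm{Vol}$. For $r>0$ put $$\nu(r) = 6\pi\Big(r + 2r\,\mathrm{csch}^2(r) - \coth(r)\big(r^2\,\mathrm{csch}^2(r) + 1\big)\Big).$$ If $f\colon \mathbb{H}^3\to\mathbb{R}$ is harmonic (that is, $C^2$ with vanishing Laplace–Beltrami operator) and $B=B_r(p)$ is the open ball of radius $r>0$ about a point $p\in\mathbb{H}^3$, then $$|df_p| \le \frac{1}{\sqrt{\nu(r)}}\,\|df\|_{L^2(B)},\qquad \|df\|_{L^2(B)} = \Big(\int_B |df|^2\,d\mathrm{Vol}\Big)^{1/2}.$$ The bound is sharp: for every $p\in\mathbb{H}^3$ there is a single harmonic function $f\colon\mathbb{H}^3\to\mathbb{R}$ with $df_p\ne 0$ for which equality holds for all $r>0$ simultaneously. -/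

import Mathlib

noncomputable section

/-- Hyperbolic 3-space in the Poincare ball model: the open unit ball of Euclidean 3-space.
Its geometry is given by the metric tensor `HyperbolicSpace3.metric` below. -/
abbrev HyperbolicSpace3 : Type := {x : EuclideanSpace ℝ (Fin 3) // ‖x‖ < 1}

namespace HyperbolicSpace3

/-- The metric tensor `g = 4 (dx₀² + dx₁² + dx₂²) / (1 - ‖x‖²)²` of constant curvature `-1`,
as the matrix of its coefficients in the coordinates `x₀, x₁, x₂`. -/
def metric (x : EuclideanSpace ℝ (Fin 3)) : Matrix (Fin 3) (Fin 3) ℝ :=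
  (4 / (1 - ‖x‖ ^ 2) ^ 2) • (1 : Matrix (Fin 3) (Fin 3) ℝ)

/-- The density `√(det g)` of the Riemannian volume with respect to Lebesgue measure. -/
def volumeDensity (x : EuclideanSpace ℝ (Fin 3)) : ℝ := √(metric x).det

/-- The Riemannian volume measure `dVol = √(det g) dx₀ dx₁ dx₂`; here `volume` is Lebesgue
measure, restricted by `comap` to the open unit ball. -/
def vol : MeasureTheory.Measure HyperbolicSpace3 :=
  (MeasureTheory.Measure.comap Subtype.val
    (MeasureTheory.volume : MeasureTheory.Measure (EuclideanSpace ℝ (Fin 3)))).withDensity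
    (fun x => ENNReal.ofReal (volumeDensity x.1))

/-- The hyperbolic distance in the ball model,
`sinh (d(x, y) / 2) = ‖x - y‖ / √((1 - ‖x‖²) (1 - ‖y‖²))`. -/
def hdist (x y : HyperbolicSpace3) : ℝ :=
  2 * Real.arsinh (‖x.1 - y.1‖ / √((1 - ‖x.1‖ ^ 2) * (1 - ‖y.1‖ ^ 2)))

/-- The open hyperbolic ball of radius `r` about `p`. -/
def hball (p : HyperbolicSpace3) (r : ℝ) : Set HyperbolicSpace3 := {x | hdist x p < r}

/-- The expression of a function on hyperbolic space in the coordinates `x₀, x₁, x₂`, extended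
by zero outside the open unit ball (only its values inside are ever used). -/
def coordRep (f : HyperbolicSpace3 → ℝ) (x : EuclideanSpace ℝ (Fin 3)) : ℝ :=
  open Classical in if h : ‖x‖ < 1 then f ⟨x, h⟩ else 0

/-- The coordinate partial derivative `∂F/∂xᵢ`. -/
def partialDeriv (i : Fin 3) (F : EuclideanSpace ℝ (Fin 3) → ℝ)
    (x : EuclideanSpace ℝ (Fin 3)) : ℝ :=
  fderiv ℝ F x (EuclideanSpace.single i 1)

/-- The Laplace-Beltrami operator in coordinates,
`(1 / √(det g)) ∑ᵢ ∂ᵢ (√(det g) ∑ⱼ gⁱʲ ∂ⱼ F)`. -/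
def laplaceBeltrami (F : EuclideanSpace ℝ (Fin 3) → ℝ) (x : EuclideanSpace ℝ (Fin 3)) : ℝ :=
  (volumeDensity x)⁻¹ * ∑ i, partialDeriv i
    (fun y => volumeDensity y * ∑ j, (metric y)⁻¹ i j * partialDeriv j F y) x

/-- A function on hyperbolic space is harmonic if it is `C²` and its Laplacian vanishes. -/
def IsHarmonic (f : HyperbolicSpace3 → ℝ) : Prop :=
  ContDiffOn ℝ 2 (coordRep f) (Metric.ball 0 1) ∧
    ∀ x : HyperbolicSpace3, laplaceBeltrami (coordRep f) x.1 = 0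

/-- The pointwise norm `|df_x| = √(∑ᵢⱼ gⁱʲ ∂ᵢf ∂ⱼf)` of the differential, for the norm on
cotangent vectors that is dual to the Riemannian metric. -/
def normDifferential (f : HyperbolicSpace3 → ℝ) (x : HyperbolicSpace3) : ℝ :=
  √(∑ i, ∑ j, (metric x.1)⁻¹ i j *
    partialDeriv i (coordRep f) x.1 * partialDeriv j (coordRep f) x.1)

/-- The norm `‖df‖_{L²(B)} = √(∫_B |df|² dVol)`. -/
def l2NormDifferential (f : HyperbolicSpace3 → ℝ) (B : Set HyperbolicSpace3) : ℝ :=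
  √(∫ x in B, normDifferential f x ^ 2 ∂vol)

/-- `ν(r) = 6π (r + 2 r csch² r - coth r (r² csch² r + 1))`. -/
def nu (r : ℝ) : ℝ :=
  6 * Real.pi * (r + 2 * r / Real.sinh r ^ 2
    - Real.cosh r / Real.sinh r * (r ^ 2 / Real.sinh r ^ 2 + 1))

end HyperbolicSpace3

end

namespace HyperbolicSpace3

open MeasureTheory Metric Set Filter Topology

local notation "E3" => EuclideanSpace ℝ (Fin 3)

/-! An isometry moves `p` to the centre of the ball model and turns `B_r(p)` into the Euclidean ball
of radius `R = tanh (r / 2)`. With `λ = 2 / (1 - |x|²)`, in dimension three the energy density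
`|df|² dVol` is `λ |∇F|² dx` and harmonicity reads `div (λ ∇F) = 0`.

For a vector `e` there is an explicit harmonic function `H = b(|x|²) ⟪x, e⟫` (`extremal`). On a
centred sphere its radial derivative is a multiple of `⟪ω, e⟫`, so Green's identity turns the energy
pairing of `F` with `H` into a multiple of the first moment `∫ F(Rω) ⟪ω, e⟫ dω`. For harmonic `F`
this moment solves a second order linear ODE in the radius that is singular at `0`. A Wronskian
argument shows that the solutions coming from smooth functions are all proportional, so the moment
is fixed by `∂_e F(0)` (`moment_proportional`).

Take `e = ∇F(0)`. Then `3/4 • H` has the same gradient at the centre as `F`, the pairing of `F` with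
`H` is known, and expanding the nonnegative energy of `F - 3/4 • H` gives the bound
(`IsBallHarmonic.energy_ge`), with the energy of `H` as the sharp constant. As `H` does not depend
on `R`, it gives equality at every radius at once. The closed form of `b` identifies the constant
with `ν` (`nu_eq`), and invariance of harmonicity and energy under `T` carries everything to an
arbitrary `p`. -/

/-! ### Polar coordinates and spherical integrals. -/

/-- The surface measure on the Euclidean unit sphere. -/
noncomputable abbrev sphereMeasure : Measure (sphere (0 : E3) 1) :=
  (volume : Measure E3).toSphere

/-- The integral over all of space in polar coordinates. -/
theorem integral_eq_integral_sphere {F : E3 → ℝ} (hF : Integrable F) :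
    ∫ x, F x = ∫ s in Ioi (0 : ℝ), s ^ 2 * ∫ ω, F (s • (ω : E3)) ∂sphereMeasure := by
  have hmp := (volume : Measure E3).measurePreserving_homeomorphUnitSphereProd
  have hdim : Module.finrank ℝ E3 - 1 = 2 := by simp
  rw [hdim] at hmp
  set G : sphere (0 : E3) 1 × Ioi (0 : ℝ) → ℝ := fun z => F ((z.2 : ℝ) • (z.1 : E3)) with hG
  have hcomp : ∀ x : ({(0)}ᶜ : Set E3), G (homeomorphUnitSphereProd E3 x) = F x := by
    intro x
    have hx : ‖(x : E3)‖ ≠ 0 := norm_ne_zero_iff.2 x.2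
    simp [hG, smul_smul, hx]
  have hme := (homeomorphUnitSphereProd E3).measurableEmbedding
  have hint : Integrable G (sphereMeasure.prod (.volumeIoiPow 2)) := by
    rw [← hmp.integrable_comp_emb hme]
    have : (G ∘ homeomorphUnitSphereProd E3) = fun x : ({(0)}ᶜ : Set E3) => F x := funext hcomp
    rw [this]
    exact (integrableOn_iff_comap_subtypeVal (measurableSet_singleton _).compl).1 hF.integrableOn
  calc ∫ x, F x = ∫ x : ({(0)}ᶜ : Set E3), F x ∂((volume : Measure E3).comap (↑)) := by
        rw [integral_subtype_comap (measurableSet_singleton _).compl F, restrict_compl_singleton]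
    _ = ∫ z, G z ∂(sphereMeasure.prod (.volumeIoiPow 2)) := by
        rw [← hmp.integral_comp hme]; simp only [hcomp]
    _ = ∫ r : Ioi (0 : ℝ), ∫ ω, F ((r : ℝ) • (ω : E3)) ∂sphereMeasure ∂(.volumeIoiPow 2) :=
        integral_prod_symm _ hint
    _ = _ := by
      simp only [Measure.volumeIoiPow, ENNReal.ofReal]
      rw [integral_withDensity_eq_integral_smul,
        integral_subtype_comap measurableSet_Ioi fun a ↦ Real.toNNReal (a ^ 2) •
          ∫ ω, F (a • (ω : E3)) ∂sphereMeasure,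
        setIntegral_congr_fun measurableSet_Ioi fun x hx ↦ ?_]
      · simp only [NNReal.smul_def, Real.coe_toNNReal _ (pow_nonneg (le_of_lt hx) _), smul_eq_mul]
      · exact (measurable_subtype_coe.pow_const _).real_toNNReal

theorem smul_sphere_mem_ball {s : ℝ} (hs : s ∈ Ioo (-1 : ℝ) 1) (ω : sphere (0 : E3) 1) :
    s • (ω : E3) ∈ ball (0 : E3) 1 := by
  have : ‖(ω : E3)‖ = 1 := by simp
  simp [norm_smul, this, abs_lt, hs.1, hs.2]

theorem continuousOn_comp_smul_sphere {F : E3 → ℝ} (hF : ContinuousOn F (ball 0 1)) :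
    ContinuousOn (fun z : ℝ × sphere (0 : E3) 1 => F (z.1 • (z.2 : E3)))
      (Ioo (-1 : ℝ) 1 ×ˢ univ) := by
  refine hF.comp (by fun_prop) ?_
  rintro ⟨s, ω⟩ ⟨hs, -⟩
  exact smul_sphere_mem_ball hs ω

theorem continuousOn_sphere_integral {K : ℝ → sphere (0 : E3) 1 → ℝ}
    (hK : ContinuousOn K.uncurry (Ioo (-1 : ℝ) 1 ×ˢ univ)) :
    ContinuousOn (fun s => ∫ ω, K s ω ∂sphereMeasure) (Ioo (-1) 1) :=
  continuousOn_integral_of_compact_support isCompact_univ hK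
    (fun _ _ _ h => absurd (mem_univ _) h)

theorem continuous_slice {K : ℝ → sphere (0 : E3) 1 → ℝ}
    (hK : ContinuousOn K.uncurry (Ioo (-1 : ℝ) 1 ×ˢ univ)) {s : ℝ} (hs : s ∈ Ioo (-1 : ℝ) 1) :
    Continuous (K s) := by
  refine hK.comp_continuous (f := fun ω => (s, ω)) (by fun_prop) fun ω => ⟨hs, mem_univ _⟩

theorem integrable_slice {K : ℝ → sphere (0 : E3) 1 → ℝ}
    (hK : ContinuousOn K.uncurry (Ioo (-1 : ℝ) 1 ×ˢ univ)) {s : ℝ} (hs : s ∈ Ioo (-1 : ℝ) 1) :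
    Integrable (K s) sphereMeasure := by
  rw [← integrableOn_univ]
  exact (continuous_slice hK hs).continuousOn.integrableOn_compact isCompact_univ

/-- The integral over a centred ball in polar coordinates. -/
theorem setIntegral_ball_eq {F : E3 → ℝ} (hF : ContinuousOn F (ball 0 1)) {R : ℝ}
    (hR : R ∈ Ioo (0 : ℝ) 1) :
    ∫ x in ball (0 : E3) R, F x =
      ∫ s in (0 : ℝ)..R, s ^ 2 * ∫ ω, F (s • (ω : E3)) ∂sphereMeasure := by
  have hint : IntegrableOn F (ball 0 R) :=
    ((hF.mono (closedBall_subset_ball hR.2)).integrableOn_compact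
      (isCompact_closedBall _ _)).mono_set ball_subset_closedBall
  rw [← integral_indicator measurableSet_ball, integral_eq_integral_sphere
    ((integrable_indicator_iff measurableSet_ball).2 hint),
    intervalIntegral.integral_of_le hR.1.le, integral_Ioc_eq_integral_Ioo]
  have : Ioo (0 : ℝ) R = Ioi 0 ∩ Iio R := rfl
  rw [this, ← setIntegral_indicator measurableSet_Iio]
  refine setIntegral_congr_fun measurableSet_Ioi fun s hs => ?_
  have hs' : 0 < s := hs
  by_cases h : s < R
  · have : ∀ ω : sphere (0 : E3) 1, s • (ω : E3) ∈ ball (0 : E3) R := fun ω => by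
      simp [norm_smul, abs_of_pos hs', h]
    simp [indicator, h, abs_of_pos hs', norm_smul]
  · simp [indicator, h, abs_of_pos hs', norm_smul]

/-! ### The divergence theorem on centred balls. -/

/-- Squaring removes the corner of the positive part. This makes the cutoff `(R² - |x|²)₊²`
differentiable everywhere, hence usable in integration by parts over the whole space. -/
theorem hasDerivAt_sq_max_zero (t : ℝ) :
    HasDerivAt (fun t : ℝ => max t 0 ^ 2) (2 * max t 0) t := by
  rcases lt_trichotomy t 0 with h | h | h
  · have : (fun t : ℝ => max t 0 ^ 2) =ᶠ[𝓝 t] fun _ => 0 := by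
      filter_upwards [Iio_mem_nhds h] with x hx
      simp [max_eq_right (le_of_lt (mem_Iio.1 hx))]
    rw [max_eq_right h.le, mul_zero]
    exact (hasDerivAt_const t (0 : ℝ)).congr_of_eventuallyEq this
  · subst h
    rw [max_self, mul_zero, hasDerivAt_iff_isLittleO_nhds_zero]
    have : (fun h : ℝ => h ^ 2) =o[𝓝 0] fun h => h := by
      simpa using (Asymptotics.isLittleO_pow_id (n := 2) (by norm_num) : _ =o[𝓝 (0 : ℝ)] _)
    refine (Asymptotics.IsBigO.of_bound 1 (Eventually.of_forall fun x => ?_)).trans_isLittleO this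
    simp only [zero_add, max_self, smul_zero, sub_zero, one_mul, norm_pow, Real.norm_eq_abs]
    norm_num
    rcases le_total x 0 with h | h
    · simp [h, sq_nonneg]
    · simp [h]
  · have : (fun t : ℝ => max t 0 ^ 2) =ᶠ[𝓝 t] fun t => t ^ 2 := by
      filter_upwards [Ioi_mem_nhds h] with x hx
      simp [max_eq_left (le_of_lt (mem_Ioi.1 hx))]
    rw [max_eq_left h.le]
    simpa using (hasDerivAt_pow 2 t).congr_of_eventuallyEq this

theorem hasFDerivAt_weight (R : ℝ) (x : E3) :
    HasFDerivAt (fun x : E3 => max (R ^ 2 - ‖x‖ ^ 2) 0 ^ 2)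
      (-(4 * max (R ^ 2 - ‖x‖ ^ 2) 0) • innerSL ℝ x) x := by
  have h1 : HasFDerivAt (fun x : E3 => R ^ 2 - ‖x‖ ^ 2) (-(2 • innerSL ℝ x)) x :=
    (hasStrictFDerivAt_norm_sq x).hasFDerivAt.const_sub _
  have := (hasDerivAt_sq_max_zero (R ^ 2 - ‖x‖ ^ 2)).comp_hasFDerivAt x h1
  refine this.congr_fderiv ?_
  ext v
  simp
  ring

theorem integrable_of_continuousOn_closedBall {G : E3 → ℝ} {R : ℝ}
    (hG : ContinuousOn G (closedBall 0 R)) (h0 : ∀ x : E3, R < ‖x‖ → G x = 0) :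
    Integrable G := by
  rw [← integrableOn_iff_integrable_of_support_subset (s := closedBall (0 : E3) R)]
  · exact hG.integrableOn_compact (isCompact_closedBall _ _)
  · intro x hx
    by_contra h
    exact hx (h0 x (by simpa using h))

theorem continuousOn_fderiv_apply {F : E3 → ℝ} (hF : ContDiffOn ℝ 1 F (ball 0 1)) (v : E3) :
    ContinuousOn (fun x => fderiv ℝ F x v) (ball 0 1) :=
  (hF.continuousOn_fderiv_of_isOpen isOpen_ball le_rfl).clm_apply continuousOn_const

/-- Integration by parts against a weight that vanishes on the bounding sphere, so no boundary term
appears. The surface term of the divergence theorem is recovered later by letting `R` vary. -/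
theorem integral_weight_mul_fderiv {F : E3 → ℝ} (hF : ContDiffOn ℝ 1 F (ball 0 1)) (v : E3)
    {R : ℝ} (hR : R ∈ Ioo (0 : ℝ) 1) :
    ∫ x in ball (0 : E3) R, ((R ^ 2 - ‖x‖ ^ 2) ^ 2 * fderiv ℝ F x v
      - 4 * (R ^ 2 - ‖x‖ ^ 2) * inner ℝ x v * F x) = 0 := by
  set w : E3 → ℝ := fun x => max (R ^ 2 - ‖x‖ ^ 2) 0 ^ 2 with hw
  have hsub : closedBall (0 : E3) R ⊆ ball 0 1 := closedBall_subset_ball hR.2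
  have hmax : ∀ x : E3, R < ‖x‖ → max (R ^ 2 - ‖x‖ ^ 2) 0 = 0 := fun x hx => by
    apply max_eq_right; nlinarith [hR.1]
  have hFc : ContinuousOn F (closedBall 0 R) := hF.continuousOn.mono hsub
  have hF'c := (continuousOn_fderiv_apply hF v).mono hsub
  have hw' : ∀ x, fderiv ℝ w x v = -(4 * max (R ^ 2 - ‖x‖ ^ 2) 0) * inner ℝ x v := fun x => by
    rw [(hasFDerivAt_weight R x).fderiv]; simp
  have hts : tsupport w ⊆ closedBall 0 R := by
    refine closure_minimal (fun x hx => ?_) isClosed_closedBall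
    by_contra h
    exact hx (by simp [hw, hmax x (by simpa using h)])
  have i1 : Integrable (fun x => fderiv ℝ w x v * F x) := by
    refine integrable_of_continuousOn_closedBall (R := R) ?_ fun x hx => ?_
    · simp only [hw']
      exact ContinuousOn.mul (by fun_prop) hFc
    · simp [hw', hmax x hx]
  have i2 : Integrable (fun x => w x * fderiv ℝ F x v) := by
    refine integrable_of_continuousOn_closedBall (R := R) ?_ fun x hx => ?_
    · exact ContinuousOn.mul (by fun_prop) hF'c
    · simp [hw, hmax x hx]
  have i3 : Integrable (fun x => w x * F x) := by
    refine integrable_of_continuousOn_closedBall (R := R) ?_ fun x hx => ?_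
    · exact ContinuousOn.mul (by fun_prop) hFc
    · simp [hw, hmax x hx]
  have key := integral_mul_fderiv_eq_neg_fderiv_mul_of_integrable (μ := volume) i1 i2 i3
    (fun x _ => (hasFDerivAt_weight R x).differentiableAt)
    (fun x hx => (hF.differentiableOn one_ne_zero).differentiableAt
      (isOpen_ball.mem_nhds (hsub (hts hx))))
  have key2 : ∫ x, (w x * fderiv ℝ F x v + fderiv ℝ w x v * F x) = 0 := by
    rw [integral_add i2 i1, key]; ring
  rw [← key2, ← integral_indicator measurableSet_ball]
  congr 1
  ext x
  by_cases hx : ‖x‖ < R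
  · have : 0 ≤ R ^ 2 - ‖x‖ ^ 2 := by nlinarith [norm_nonneg x]
    rw [hw']
    simp [indicator, hx, hw, max_eq_left this]
    ring
  · have : max (R ^ 2 - ‖x‖ ^ 2) 0 = 0 := by
      apply max_eq_right; nlinarith [hR.1, norm_nonneg x]
    rw [hw']
    simp [indicator, hx, hw, this]

theorem continuousOn_mul_sphere {F : E3 → ℝ} (hF : ContinuousOn F (ball 0 1))
    {g : sphere (0 : E3) 1 → ℝ} (hg : Continuous g) :
    ContinuousOn (fun z : ℝ × sphere (0 : E3) 1 => F (z.1 • (z.2 : E3)) * g z.2)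
      (Ioo (-1 : ℝ) 1 ×ˢ univ) :=
  (continuousOn_comp_smul_sphere hF).mul (by fun_prop)

/-- A continuous function on `(-1, 1)` all of whose weighted integrals with weights
`s (R² - s²)` over `(0, R)` vanish is zero on `(0, 1)`. -/
theorem eq_zero_of_integral_weight_eq_zero {D : ℝ → ℝ} (hD : ContinuousOn D (Ioo (-1) 1))
    (h : ∀ R ∈ Ioo (0 : ℝ) 1, ∫ s in (0 : ℝ)..R, s * (R ^ 2 - s ^ 2) * D s = 0) :
    ∀ R ∈ Ioo (0 : ℝ) 1, D R = 0 := by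
  have sub : ∀ R ∈ Ioo (0 : ℝ) 1, uIcc 0 R ⊆ Ioo (-1 : ℝ) 1 := fun R hR => by
    rw [uIcc_of_le hR.1.le]
    exact fun x hx => ⟨by linarith [hx.1], by linarith [hx.2, hR.2]⟩
  have hd : ∀ G : ℝ → ℝ, ContinuousOn G (Ioo (-1) 1) → ∀ R ∈ Ioo (0 : ℝ) 1,
      HasDerivAt (fun R => ∫ s in (0 : ℝ)..R, G s) (G R) R := fun G hG R hR => by
    have hmem : Ioo (-1 : ℝ) 1 ∈ 𝓝 R := Ioo_mem_nhds (by linarith [hR.1]) hR.2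
    exact intervalIntegral.integral_hasDerivAt_right
      ((hG.mono (sub R hR)).intervalIntegrable)
      (hG.stronglyMeasurableAtFilter isOpen_Ioo R (mem_of_mem_nhds hmem))
      (hG.continuousAt hmem)
  have hz : ∀ H : ℝ → ℝ, (∀ R ∈ Ioo (0 : ℝ) 1, H R = 0) → ∀ R ∈ Ioo (0 : ℝ) 1, ∀ d,
      HasDerivAt H d R → d = 0 := fun H hH R hR d hd => by
    refine hd.unique ((hasDerivAt_const R (0 : ℝ)).congr_of_eventuallyEq ?_)
    filter_upwards [Ioo_mem_nhds hR.1 hR.2] with x hx using hH x hx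
  have c1 : ContinuousOn (fun s => s * D s) (Ioo (-1) 1) := continuousOn_id.mul hD
  have c3 : ContinuousOn (fun s => s ^ 3 * D s) (Ioo (-1) 1) := (continuousOn_pow 3).mul hD
  -- Splitting the weight isolates the dependence on `R`. On differentiating, the two terms `R³
  -- D(R)` cancel and `2R ∫ s D` is left; a second differentiation then gives `R D(R) = 0`.
  have h1 : ∀ R ∈ Ioo (0 : ℝ) 1,
      R ^ 2 * (∫ s in (0 : ℝ)..R, s * D s) - ∫ s in (0 : ℝ)..R, s ^ 3 * D s = 0 := fun R hR => by
    refine Eq.trans ?_ (h R hR)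
    rw [← intervalIntegral.integral_const_mul, ← intervalIntegral.integral_sub
      (((c1.mono (sub R hR)).intervalIntegrable).const_mul _)
      ((c3.mono (sub R hR)).intervalIntegrable)]
    congr 1; ext s; ring
  have h2 : ∀ R ∈ Ioo (0 : ℝ) 1, ∫ s in (0 : ℝ)..R, s * D s = 0 := fun R hR => by
    have := hz _ h1 R hR _ (((hasDerivAt_pow 2 R).mul (hd _ c1 R hR)).sub (hd _ c3 R hR))
    have h' : R * (∫ s in (0 : ℝ)..R, s * D s) = 0 := by
      norm_num at this; linarith
    exact (mul_eq_zero.1 h').resolve_left hR.1.ne'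
  intro R hR
  exact (mul_eq_zero.1 (hz _ h2 R hR _ (hd _ c1 R hR))).resolve_left hR.1.ne'

/-- The flux of the constant direction `v` weighted by `F` through the sphere of radius `s` has
derivative the spherical integral of the directional derivative of `F`. -/
theorem hasDerivAt_flux {F : E3 → ℝ} (hF : ContDiffOn ℝ 1 F (ball 0 1)) (v : E3)
    {s : ℝ} (hs : s ∈ Ioo (0 : ℝ) 1) :
    HasDerivAt (fun s => s ^ 2 * ∫ ω, F (s • (ω : E3)) * inner ℝ (ω : E3) v ∂sphereMeasure)
      (s ^ 2 * ∫ ω, fderiv ℝ F (s • (ω : E3)) v ∂sphereMeasure) s := by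
  have hF' := continuousOn_fderiv_apply hF v
  have kB : ContinuousOn (fun z : ℝ × sphere (0 : E3) 1 => F (z.1 • (z.2 : E3)) *
      inner ℝ (z.2 : E3) v) (Ioo (-1 : ℝ) 1 ×ˢ univ) :=
    continuousOn_mul_sphere hF.continuousOn (g := fun ω => inner ℝ (ω : E3) v) (by fun_prop)
  have kA := continuousOn_comp_smul_sphere hF'
  set A : ℝ → ℝ := fun s => ∫ ω, fderiv ℝ F (s • (ω : E3)) v ∂sphereMeasure with hA
  set B : ℝ → ℝ := fun s => ∫ ω, F (s • (ω : E3)) * inner ℝ (ω : E3) v ∂sphereMeasure with hB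
  have cA : ContinuousOn A (Ioo (-1) 1) :=
    continuousOn_sphere_integral (K := fun s ω => fderiv ℝ F (s • (ω : E3)) v) kA
  have cB : ContinuousOn B (Ioo (-1) 1) :=
    continuousOn_sphere_integral (K := fun s ω => F (s • (ω : E3)) * inner ℝ (ω : E3) v) kB
  set P : ℝ → ℝ := fun R => ∫ s in (0 : ℝ)..R, s ^ 2 * A s with hP
  have sub : ∀ R ∈ Ioo (-1 : ℝ) 1, uIcc 0 R ⊆ Ioo (-1 : ℝ) 1 := fun R hR =>
    (convex_Ioo (-1 : ℝ) 1).ordConnected.uIcc_subset (by simp) hR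
  have cA2 : ContinuousOn (fun s => s ^ 2 * A s) (Ioo (-1) 1) := (continuousOn_pow 2).mul cA
  have dP : ∀ R ∈ Ioo (-1 : ℝ) 1, HasDerivAt P (R ^ 2 * A R) R := fun R hR => by
    have hmem : Ioo (-1 : ℝ) 1 ∈ 𝓝 R := Ioo_mem_nhds hR.1 hR.2
    exact intervalIntegral.integral_hasDerivAt_right
      ((cA2.mono (sub R hR)).intervalIntegrable)
      (cA2.stronglyMeasurableAtFilter isOpen_Ioo R hR) (cA2.continuousAt hmem)
  have cP : ContinuousOn P (Ioo (-1) 1) := fun R hR => (dP R hR).continuousAt.continuousWithinAt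
  have cQ : ContinuousOn (fun s => s ^ 2 * B s) (Ioo (-1) 1) := (continuousOn_pow 2).mul cB
  -- The integrated divergence theorem: volume integral `P` equals flux. Its difference is tested
  -- against all the weights `s (R² - s²)`, which is what the identity on balls provides in polar
  -- coordinates.
  have hPQ : ∀ R ∈ Ioo (0 : ℝ) 1, P R - R ^ 2 * B R = 0 := by
    refine eq_zero_of_integral_weight_eq_zero (cP.sub cQ) fun R hR => ?_
    have hR' : R ∈ Ioo (-1 : ℝ) 1 := ⟨by linarith [hR.1], hR.2⟩
    have h1 := integral_weight_mul_fderiv hF v hR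
    rw [setIntegral_ball_eq (by
      refine ContinuousOn.sub (ContinuousOn.mul (by fun_prop) hF')
        (ContinuousOn.mul (by fun_prop) hF.continuousOn)) hR] at h1
    have h2 : ∀ s ∈ uIcc 0 R, s ^ 2 * ∫ ω : sphere (0 : E3) 1,
        ((R ^ 2 - ‖s • (ω : E3)‖ ^ 2) ^ 2 * fderiv ℝ F (s • (ω : E3)) v
        - 4 * (R ^ 2 - ‖s • (ω : E3)‖ ^ 2) * inner ℝ (s • (ω : E3)) v * F (s • (ω : E3)))
          ∂sphereMeasure
        = (R ^ 2 - s ^ 2) ^ 2 * (s ^ 2 * A s) - 4 * s * (R ^ 2 - s ^ 2) * (s ^ 2 * B s) := by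
      intro s hs
      have hs' := sub R hR' hs
      have e : ∀ ω : sphere (0 : E3) 1,
          ((R ^ 2 - ‖s • (ω : E3)‖ ^ 2) ^ 2 * fderiv ℝ F (s • (ω : E3)) v
          - 4 * (R ^ 2 - ‖s • (ω : E3)‖ ^ 2) * inner ℝ (s • (ω : E3)) v * F (s • (ω : E3)))
          = (R ^ 2 - s ^ 2) ^ 2 * fderiv ℝ F (s • (ω : E3)) v
          - (4 * s * (R ^ 2 - s ^ 2)) * (F (s • (ω : E3)) * inner ℝ (ω : E3) v) := fun ω => by
        rw [norm_smul, real_inner_smul_left]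
        simp only [norm_eq_of_mem_sphere, mul_one, Real.norm_eq_abs, sq_abs]
        ring
      simp only [e]
      rw [integral_sub ((integrable_slice (K := fun s ω => fderiv ℝ F (s • (ω : E3)) v)
        kA hs').const_mul _) ((integrable_slice
          (K := fun s ω => F (s • (ω : E3)) * inner ℝ (ω : E3) v) kB hs').const_mul _),
        integral_const_mul, integral_const_mul]
      ring
    have iA : IntervalIntegrable (fun s => (R ^ 2 - s ^ 2) ^ 2 * (s ^ 2 * A s)) volume 0 R :=
      ContinuousOn.intervalIntegrable (ContinuousOn.mul (by fun_prop) (cA2.mono (sub R hR')))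
    have iQ : IntervalIntegrable (fun s => 4 * s * (R ^ 2 - s ^ 2) * (s ^ 2 * B s)) volume 0 R :=
      ContinuousOn.intervalIntegrable (ContinuousOn.mul (by fun_prop) (cQ.mono (sub R hR')))
    have iP : IntervalIntegrable (fun s => -(-(4 * s * (R ^ 2 - s ^ 2)) * P s)) volume 0 R :=
      ContinuousOn.intervalIntegrable
        (ContinuousOn.neg (ContinuousOn.mul (by fun_prop) (cP.mono (sub R hR'))))
    rw [intervalIntegral.integral_congr h2, intervalIntegral.integral_sub iA iQ] at h1
    -- The derivative is moved from `P` to the weight; the boundary terms drop out because the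
    -- weight vanishes at `R` and `P` at `0`.
    have h3 := intervalIntegral.integral_mul_deriv_eq_deriv_mul (a := 0) (b := R)
      (u := fun s => (R ^ 2 - s ^ 2) ^ 2) (u' := fun s => - (4 * s * (R ^ 2 - s ^ 2)))
      (v := P) (v' := fun s => s ^ 2 * A s)
      (fun s _ => by
        have := (((hasDerivAt_pow 2 s).const_sub (R ^ 2)).pow 2)
        refine this.congr_deriv ?_
        norm_num; ring)
      (fun s hs => dP s (sub R hR' hs))
      (Continuous.intervalIntegrable (by fun_prop) _ _)
      ((cA2.mono (sub R hR')).intervalIntegrable)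
    rw [h3] at h1
    have hP0 : P 0 = 0 := by simp [hP]
    rw [hP0] at h1
    have h4 : ∫ s in (0 : ℝ)..R, s * (R ^ 2 - s ^ 2) * (P s - s ^ 2 * B s)
        = (1 / 4) * ((-∫ s in (0 : ℝ)..R, -(4 * s * (R ^ 2 - s ^ 2)) * P s)
          - ∫ s in (0 : ℝ)..R, 4 * s * (R ^ 2 - s ^ 2) * (s ^ 2 * B s)) := by
      rw [← intervalIntegral.integral_neg, ← intervalIntegral.integral_sub iP iQ,
        ← intervalIntegral.integral_const_mul]
      congr 1; ext s; ring
    rw [h4]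
    linarith
  refine (dP s ⟨by linarith [hs.1], hs.2⟩).congr_of_eventuallyEq ?_
  filter_upwards [Ioo_mem_nhds hs.1 hs.2] with x hx
  linarith [hPQ x hx]

/-! ### Harmonicity in divergence form and coordinate calculus. -/

/-- The conformal factor of the Poincare metric. -/
noncomputable def conformalFactor (x : E3) : ℝ := 2 / (1 - ‖x‖ ^ 2)

/-- Harmonicity on the unit ball in divergence form, `div (conformalFactor • ∇F) = 0`. -/
def IsBallHarmonic (F : E3 → ℝ) : Prop :=
  ContDiffOn ℝ 2 F (ball 0 1) ∧ ∀ x ∈ ball (0 : E3) 1,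
    ∑ i, partialDeriv i (fun y => conformalFactor y * partialDeriv i F y) x = 0

theorem fderiv_eq_sum_partialDeriv (F : E3 → ℝ) (x v : E3) :
    fderiv ℝ F x v = ∑ i, partialDeriv i F x * v i := by
  have hv : v = ∑ i, v i • EuclideanSpace.single i (1 : ℝ) := by
    ext j; simp [Fin.sum_univ_three]; fin_cases j <;> simp
  conv_lhs => rw [hv]
  simp [partialDeriv, mul_comm]

theorem contDiffOn_partialDeriv {F : E3 → ℝ} (hF : ContDiffOn ℝ 2 F (ball 0 1)) (i : Fin 3) :
    ContDiffOn ℝ 1 (partialDeriv i F) (ball 0 1) :=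
  (hF.fderiv_of_isOpen isOpen_ball (by norm_num)).clm_apply contDiffOn_const

theorem one_sub_norm_sq_pos {x : E3} (hx : x ∈ ball (0 : E3) 1) : 0 < 1 - ‖x‖ ^ 2 := by
  have : ‖x‖ < 1 := by simpa using hx
  nlinarith [norm_nonneg x]

theorem conformalFactor_pos {x : E3} (hx : x ∈ ball (0 : E3) 1) : 0 < conformalFactor x :=
  div_pos two_pos (one_sub_norm_sq_pos hx)

theorem contDiffOn_conformalFactor {n : WithTop ℕ∞} :
    ContDiffOn ℝ n conformalFactor (ball 0 1) := by
  unfold conformalFactor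
  refine contDiffOn_const.div (contDiffOn_const.sub (contDiff_norm_sq ℝ).contDiffOn) ?_
  exact fun x hx => (one_sub_norm_sq_pos hx).ne'

theorem contDiffOn_conformalFactor_mul {F : E3 → ℝ} (hF : ContDiffOn ℝ 2 F (ball 0 1))
    (i : Fin 3) :
    ContDiffOn ℝ 1 (fun y => conformalFactor y * partialDeriv i F y) (ball 0 1) :=
  contDiffOn_conformalFactor.mul (contDiffOn_partialDeriv hF i)

theorem partialDeriv_mul {F G : E3 → ℝ} {x : E3} (hF : DifferentiableAt ℝ F x)
    (hG : DifferentiableAt ℝ G x) (i : Fin 3) :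
    partialDeriv i (fun y => F y * G y) x
      = F x * partialDeriv i G x + partialDeriv i F x * G x := by
  unfold partialDeriv
  rw [show (fun y => F y * G y) = F * G from rfl, fderiv_mul hF hG]
  simp [mul_comm]

theorem partialDeriv_inner (e x : E3) (i : Fin 3) :
    partialDeriv i (fun y => inner ℝ y e) x = e i := by
  have : (fun y : E3 => inner ℝ y e) = innerSL ℝ e := by
    ext y; simp [real_inner_comm]
  rw [partialDeriv, this, ContinuousLinearMap.fderiv]
  simp only [innerSL_apply_apply, EuclideanSpace.inner_single_right, one_mul, conj_trivial]

theorem partialDeriv_coord (x : E3) (i : Fin 3) :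
    partialDeriv i (fun y : E3 => y i) x = 1 := by
  have h := partialDeriv_inner (EuclideanSpace.single i 1) x i
  simpa only [EuclideanSpace.inner_single_right, one_mul, conj_trivial, PiLp.single_apply,
    if_true] using h

theorem differentiableAt_inner_left (e x : E3) :
    DifferentiableAt ℝ (fun y : E3 => inner ℝ y e) x :=
  differentiableAt_id.inner ℝ (differentiableAt_const e)

theorem differentiableAt_of_contDiffOn {F : E3 → ℝ} (hF : ContDiffOn ℝ 1 F (ball 0 1)) {x : E3}
    (hx : x ∈ ball (0 : E3) 1) : DifferentiableAt ℝ F x :=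
  (hF.differentiableOn one_ne_zero).differentiableAt (isOpen_ball.mem_nhds hx)

theorem Ioo_zero_one_subset : Ioo (0 : ℝ) 1 ⊆ Ioo (-1) 1 := Ioo_subset_Ioo (by norm_num) le_rfl

/-- The divergence theorem on centred balls, differentiated in the radius. -/
theorem hasDerivAt_divergence {V : Fin 3 → E3 → ℝ}
    (hV : ∀ i, ContDiffOn ℝ 1 (V i) (ball 0 1)) {s : ℝ} (hs : s ∈ Ioo (0 : ℝ) 1) :
    HasDerivAt (fun s => s ^ 2 * ∫ ω : sphere (0 : E3) 1,
        ∑ i, V i (s • (ω : E3)) * (ω : E3) i ∂sphereMeasure)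
      (s ^ 2 * ∫ ω : sphere (0 : E3) 1,
        ∑ i, partialDeriv i (V i) (s • (ω : E3)) ∂sphereMeasure) s := by
  have h := HasDerivAt.fun_sum (u := Finset.univ) fun i _ =>
    hasDerivAt_flux (hV i) (EuclideanSpace.single i 1) hs
  simp only [EuclideanSpace.inner_single_right, one_mul, conj_trivial] at h
  have e : s ^ 2 * ∫ ω : sphere (0 : E3) 1,
        ∑ i, partialDeriv i (V i) (s • (ω : E3)) ∂sphereMeasure = ∑ i, s ^ 2 * ∫ ω,
        fderiv ℝ (V i) (s • (ω : E3)) (EuclideanSpace.single i 1) ∂sphereMeasure := by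
    rw [integral_finsetSum, Finset.mul_sum]
    · rfl
    · exact fun i _ => integrable_slice
        (K := fun s ω => fderiv ℝ (V i) (s • (ω : E3)) (EuclideanSpace.single i 1))
        (continuousOn_comp_smul_sphere (continuousOn_fderiv_apply (hV i) _))
        (Ioo_zero_one_subset hs)
  rw [e]
  refine h.congr_of_eventuallyEq ?_
  filter_upwards [Ioo_mem_nhds hs.1 hs.2] with t ht
  rw [integral_finsetSum, Finset.mul_sum]
  exact fun i _ => integrable_slice (K := fun s ω => V i (s • (ω : E3)) * (ω : E3) i)
        (continuousOn_mul_sphere (hV i).continuousOn (g := fun ω => (ω : E3) i) (by fun_prop))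
        (Ioo_zero_one_subset ht)

/-- For linear `L` the flux is `s³` times the integral sought, while the divergence is the constant
`L e`. Comparing derivatives at any one radius, here `1/2`, gives the value. -/
theorem integral_sphere_linear_mul_inner (L : E3 →L[ℝ] ℝ) (e : E3) :
    ∫ ω : sphere (0 : E3) 1, L ω * inner ℝ (ω : E3) e ∂sphereMeasure
      = 4 * Real.pi / 3 * L e := by
  have hs : (1 / 2 : ℝ) ∈ Ioo (0 : ℝ) 1 := by norm_num
  have h := hasDerivAt_flux (F := L) L.contDiff.contDiffOn e hs
  simp only [ContinuousLinearMap.fderiv, map_smul, smul_eq_mul, mul_assoc, integral_const,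
    integral_const_mul] at h
  have h2 : HasDerivAt (fun s : ℝ => s ^ 2 * (s * ∫ ω : sphere (0 : E3) 1,
      L ω * inner ℝ (ω : E3) e ∂sphereMeasure)) (3 * (1 / 2) ^ 2 * ∫ ω : sphere (0 : E3) 1,
      L ω * inner ℝ (ω : E3) e ∂sphereMeasure) (1 / 2) := by
    have := (hasDerivAt_pow 3 (1 / 2 : ℝ)).mul_const (∫ ω : sphere (0 : E3) 1,
      L ω * inner ℝ (ω : E3) e ∂sphereMeasure)
    refine (this.congr_of_eventuallyEq (Eventually.of_forall fun s => ?_)).congr_deriv ?_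
    · ring
    · norm_num
  have h3 := h.unique h2
  have hv : sphereMeasure.real univ = 4 * Real.pi := by
    rw [sphereMeasure, Measure.toSphere_real_apply_univ, Measure.real,
      EuclideanSpace.volume_ball_fin_three, ENNReal.ofReal_one, one_pow, one_mul,
      ENNReal.toReal_ofReal (by positivity)]
    simp
    ring
  rw [hv] at h3
  linarith

/-! ### First spherical moments and their differential equation. -/

/-- The first spherical moment of `F` in the direction `e` on the sphere of radius `s`. -/
noncomputable def moment (F : E3 → ℝ) (e : E3) (s : ℝ) : ℝ :=
  ∫ ω : sphere (0 : E3) 1, F (s • (ω : E3)) * inner ℝ (ω : E3) e ∂sphereMeasure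

/-- The first spherical moment of the radial derivative of `F`. -/
noncomputable def momentDeriv (F : E3 → ℝ) (e : E3) (s : ℝ) : ℝ :=
  ∫ ω : sphere (0 : E3) 1, fderiv ℝ F (s • (ω : E3)) ω * inner ℝ (ω : E3) e ∂sphereMeasure

theorem continuousOn_radialDeriv {F : E3 → ℝ} (hF : ContDiffOn ℝ 1 F (ball 0 1)) :
    ContinuousOn (fun z : ℝ × sphere (0 : E3) 1 => fderiv ℝ F (z.1 • (z.2 : E3)) z.2)
      (Ioo (-1 : ℝ) 1 ×ˢ univ) := by
  refine ContinuousOn.clm_apply ?_ (by fun_prop)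
  refine (hF.continuousOn_fderiv_of_isOpen isOpen_ball le_rfl).comp
    (f := fun z : ℝ × sphere (0 : E3) 1 => z.1 • (z.2 : E3)) (by fun_prop) ?_
  rintro ⟨s, ω⟩ ⟨hs, -⟩
  exact smul_sphere_mem_ball hs ω

theorem continuousOn_moment {F : E3 → ℝ} (hF : ContDiffOn ℝ 1 F (ball 0 1)) (e : E3) :
    ContinuousOn (moment F e) (Ioo (-1) 1) :=
  continuousOn_sphere_integral (K := fun s ω => F (s • (ω : E3)) * inner ℝ (ω : E3) e)
    (continuousOn_mul_sphere hF.continuousOn (g := fun ω => inner ℝ (ω : E3) e) (by fun_prop))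

theorem continuousOn_momentDeriv {F : E3 → ℝ} (hF : ContDiffOn ℝ 1 F (ball 0 1)) (e : E3) :
    ContinuousOn (momentDeriv F e) (Ioo (-1) 1) :=
  continuousOn_sphere_integral
    (K := fun s ω => fderiv ℝ F (s • (ω : E3)) ω * inner ℝ (ω : E3) e)
    ((continuousOn_radialDeriv hF).mul (by fun_prop))

theorem momentDeriv_zero (F : E3 → ℝ) (e : E3) :
    momentDeriv F e 0 = 4 * Real.pi / 3 * fderiv ℝ F 0 e := by
  simp only [momentDeriv, zero_smul]
  exact integral_sphere_linear_mul_inner _ _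

/-- The field `x ⟪x, e⟫ F(x)` has flux `s⁴` times the moment, and its divergence involves only `F`
and its radial derivative. The divergence theorem thus replaces differentiation under the integral
sign. -/
theorem hasDerivAt_moment {F : E3 → ℝ} (hF : ContDiffOn ℝ 1 F (ball 0 1)) (e : E3)
    {s : ℝ} (hs : s ∈ Ioo (0 : ℝ) 1) :
    HasDerivAt (moment F e) (momentDeriv F e s) s := by
  have hi : ContDiff ℝ 1 (fun x : E3 => inner ℝ x e) := contDiff_id.inner ℝ contDiff_const
  have hG : ContDiffOn ℝ 1 (fun x => inner ℝ x e * F x) (ball 0 1) := hi.contDiffOn.mul hF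
  have hV : ∀ i : Fin 3, ContDiffOn ℝ 1 (fun x : E3 => x i * (inner ℝ x e * F x)) (ball 0 1) :=
    fun i => ContDiffOn.mul (by fun_prop) hG
  have h := hasDerivAt_divergence hV hs
  have e1 : ∀ x ∈ ball (0 : E3) 1,
      ∑ i, partialDeriv i (fun x : E3 => x i * (inner ℝ x e * F x)) x
        = 4 * (inner ℝ x e * F x) + inner ℝ x e * fderiv ℝ F x x := by
    intro x hx
    have hd := differentiableAt_of_contDiffOn hF hx
    have : ∀ i, partialDeriv i (fun x : E3 => x i * (inner ℝ x e * F x)) x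
        = x i * (inner ℝ x e * partialDeriv i F x + e i * F x) + 1 * (inner ℝ x e * F x) := by
      intro i
      rw [partialDeriv_mul (by fun_prop) (differentiableAt_of_contDiffOn hG hx),
        partialDeriv_mul (differentiableAt_inner_left e x) hd, partialDeriv_inner, partialDeriv_coord]
    simp only [this]
    rw [fderiv_eq_sum_partialDeriv]
    have hin : inner ℝ x e = ∑ i, x i * e i := by
      simp [PiLp.inner_apply, mul_comm]
    simp only [Fin.sum_univ_three] at hin ⊢
    linear_combination (-F x) * hin
  have hs' := Ioo_zero_one_subset hs
  have iF : Integrable (fun ω : sphere (0 : E3) 1 => F (s • (ω : E3)) * inner ℝ (ω : E3) e)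
      sphereMeasure :=
    integrable_slice (K := fun s ω => F (s • (ω : E3)) * inner ℝ (ω : E3) e)
    (continuousOn_mul_sphere hF.continuousOn (g := fun ω => inner ℝ (ω : E3) e) (by fun_prop)) hs'
  have iF' : Integrable (fun ω : sphere (0 : E3) 1 =>
      fderiv ℝ F (s • (ω : E3)) ω * inner ℝ (ω : E3) e) sphereMeasure :=
    integrable_slice (K := fun s ω => fderiv ℝ F (s • (ω : E3)) ω * inner ℝ (ω : E3) e)
    ((continuousOn_radialDeriv hF).mul (by fun_prop)) hs'
  have h2 : HasDerivAt (fun s => s ^ 4 * moment F e s)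
      (4 * s ^ 3 * moment F e s + s ^ 4 * momentDeriv F e s) s := by
    refine (h.congr_of_eventuallyEq (Eventually.of_forall fun t => ?_)).congr_deriv ?_
    · have : ∀ ω : sphere (0 : E3) 1, ∑ i, ((t • (ω : E3)) i * (inner ℝ (t • (ω : E3)) e *
          F (t • (ω : E3)))) * (ω : E3) i
          = t ^ 2 * (F (t • (ω : E3)) * inner ℝ (ω : E3) e) := by
        intro ω
        have hn : ∑ i, (ω : E3) i * (ω : E3) i = 1 := by
          have := EuclideanSpace.real_norm_sq_eq (ω : E3)
          rw [norm_eq_of_mem_sphere, one_pow] at this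
          simp only [this, pow_two]
        rw [real_inner_smul_left]
        simp only [PiLp.smul_apply, smul_eq_mul, Fin.sum_univ_three] at hn ⊢
        linear_combination (t ^ 2 * F (t • (ω : E3)) * inner ℝ (ω : E3) e) * hn
      simp only [this, integral_const_mul, moment]
      ring
    · have : ∀ ω : sphere (0 : E3) 1,
          ∑ i, partialDeriv i (fun x : E3 => x i * (inner ℝ x e * F x)) (s • (ω : E3))
          = 4 * s * (F (s • (ω : E3)) * inner ℝ (ω : E3) e)
            + s ^ 2 * (fderiv ℝ F (s • (ω : E3)) ω * inner ℝ (ω : E3) e) := by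
        intro ω
        rw [e1 _ (smul_sphere_mem_ball hs' ω), real_inner_smul_left, map_smul, smul_eq_mul]
        ring
      simp only [this]
      rw [integral_add (iF.const_mul _) (iF'.const_mul _), integral_const_mul, integral_const_mul]
      unfold moment momentDeriv
      ring
  have hs4 : s ^ 4 ≠ 0 := pow_ne_zero _ hs.1.ne'
  have h3 := h2.div (hasDerivAt_pow 4 s) hs4
  refine (h3.congr_of_eventuallyEq ?_).congr_deriv ?_
  · filter_upwards [Ioo_mem_nhds hs.1 hs.2] with t ht
    have := ht.1.ne'
    simp only [Pi.div_apply]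
    field_simp
  · have := hs.1.ne'
    field_simp
    push_cast
    ring

theorem conformalFactor_smul_sphere (s : ℝ) (ω : sphere (0 : E3) 1) :
    conformalFactor (s • (ω : E3)) = 2 / (1 - s ^ 2) := by
  simp [conformalFactor, norm_smul]

/-- The second order equation satisfied by the first spherical moments of a harmonic function. -/
theorem IsBallHarmonic.hasDerivAt_momentDeriv {F : E3 → ℝ} (hF : IsBallHarmonic F) (e : E3)
    {s : ℝ} (hs : s ∈ Ioo (0 : ℝ) 1) :
    HasDerivAt (fun s => s ^ 2 * (2 / (1 - s ^ 2)) * momentDeriv F e s)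
      (2 * (2 / (1 - s ^ 2)) * moment F e s) s := by
  have hF1 : ContDiffOn ℝ 1 F (ball 0 1) := hF.1.of_le (by norm_num)
  have hi : ContDiff ℝ 1 (fun x : E3 => inner ℝ x e) := contDiff_id.inner ℝ contDiff_const
  have hW := contDiffOn_conformalFactor_mul hF.1
  -- For `⟪x, e⟫ λ ∇F` harmonicity cancels the second order part of the divergence and leaves `λ ∂_e
  -- F`.
  have h := hasDerivAt_divergence (V := fun i x => inner ℝ x e *
    (conformalFactor x * partialDeriv i F x)) (fun i => hi.contDiffOn.mul (hW i)) hs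
  have hs' := Ioo_zero_one_subset hs
  have e1 : ∀ x ∈ ball (0 : E3) 1, ∑ i, partialDeriv i (fun x => inner ℝ x e *
      (conformalFactor x * partialDeriv i F x)) x = conformalFactor x * fderiv ℝ F x e := by
    intro x hx
    have : ∀ i, partialDeriv i (fun x => inner ℝ x e *
        (conformalFactor x * partialDeriv i F x)) x = inner ℝ x e *
        partialDeriv i (fun y => conformalFactor y * partialDeriv i F y) x
        + e i * (conformalFactor x * partialDeriv i F x) := fun i => by
      rw [partialDeriv_mul (differentiableAt_inner_left e x) (differentiableAt_of_contDiffOn (hW i) hx),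
        partialDeriv_inner]
    simp only [this]
    rw [Finset.sum_add_distrib, ← Finset.mul_sum, hF.2 x hx, fderiv_eq_sum_partialDeriv,
      Finset.mul_sum, mul_zero, zero_add]
    exact Finset.sum_congr rfl fun i _ => by ring
  have h2 : HasDerivAt (fun s => s * (s ^ 2 * (2 / (1 - s ^ 2)) * momentDeriv F e s))
      ((2 / (1 - s ^ 2)) * (s ^ 2 * ∫ ω, fderiv ℝ F (s • (ω : E3)) e ∂sphereMeasure)) s := by
    refine (h.congr_of_eventuallyEq (Eventually.of_forall fun t => ?_)).congr_deriv ?_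
    · have : ∀ ω : sphere (0 : E3) 1, ∑ i, (inner ℝ (t • (ω : E3)) e *
          (conformalFactor (t • (ω : E3)) * partialDeriv i F (t • (ω : E3)))) * (ω : E3) i
          = t * (2 / (1 - t ^ 2)) * (fderiv ℝ F (t • (ω : E3)) ω * inner ℝ (ω : E3) e) := by
        intro ω
        rw [real_inner_smul_left, conformalFactor_smul_sphere, fderiv_eq_sum_partialDeriv]
        simp only [Fin.sum_univ_three]
        ring
      simp only [this, integral_const_mul, momentDeriv]
      ring
    · simp only [e1 _ (smul_sphere_mem_ball hs' _), conformalFactor_smul_sphere,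
        integral_const_mul]
      ring
  -- Two expressions for the derivative of `s²` times the moment: the flux formula gives the
  -- spherical integral of `∂_e F`, the product rule gives moments. This eliminates `∂_e F` and
  -- closes the equation.
  have h3 := (hasDerivAt_flux hF1 e hs).unique
    ((hasDerivAt_pow 2 s).mul (hasDerivAt_moment hF1 e hs))
  rw [h3] at h2
  have h4 := h2.div (hasDerivAt_id s) hs.1.ne'
  have hs1 : (1 - s ^ 2) ≠ 0 := by nlinarith [hs.1, hs.2]
  refine (h4.congr_of_eventuallyEq ?_).congr_deriv ?_
  · filter_upwards [Ioo_mem_nhds hs.1 hs.2] with t ht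
    simp only [Pi.div_apply, id]
    rw [mul_div_cancel_left₀ _ ht.1.ne']
  · have := hs.1.ne'
    have : moment F e s = ∫ ω : sphere (0 : E3) 1,
      F (s • (ω : E3)) * inner ℝ (ω : E3) e ∂sphereMeasure := rfl
    simp only [id, ← this]
    field_simp
    push_cast
    ring

/-- Both moments solve `(s² λ m')' = 2 λ m`, so their weighted Wronskian is constant. The factor
`s²` makes it zero at the centre, where the moments stay continuous. -/
theorem moment_wronskian {F H : E3 → ℝ} (hF : IsBallHarmonic F) (hH : IsBallHarmonic H) (e : E3)
    {R : ℝ} (hR : R ∈ Ioo (0 : ℝ) 1) :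
    momentDeriv F e R * moment H e R = moment F e R * momentDeriv H e R := by
  have hF1 : ContDiffOn ℝ 1 F (ball 0 1) := hF.1.of_le (by norm_num)
  have hH1 : ContDiffOn ℝ 1 H (ball 0 1) := hH.1.of_le (by norm_num)
  set W : ℝ → ℝ := fun s => (s ^ 2 * (2 / (1 - s ^ 2)) * momentDeriv F e s) * moment H e s
    - moment F e s * (s ^ 2 * (2 / (1 - s ^ 2)) * momentDeriv H e s) with hW
  have hsub : Icc 0 R ⊆ Ioo (-1 : ℝ) 1 := fun x hx => ⟨by linarith [hx.1], by linarith [hx.2, hR.2]⟩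
  have hd : ∀ s ∈ Ioo 0 R, HasDerivAt W 0 s := fun s hs => by
    have hs' : s ∈ Ioo (0 : ℝ) 1 := ⟨hs.1, hs.2.trans hR.2⟩
    refine (((hF.hasDerivAt_momentDeriv e hs').mul (hasDerivAt_moment hH1 e hs')).sub
      ((hasDerivAt_moment hF1 e hs').mul (hH.hasDerivAt_momentDeriv e hs'))).congr_deriv ?_
    ring
  have hc : ContinuousOn W (Icc 0 R) := by
    have h1 : ContinuousOn (fun s : ℝ => s ^ 2 * (2 / (1 - s ^ 2))) (Icc 0 R) := by
      refine (continuousOn_pow 2).mul (continuousOn_const.div (by fun_prop) fun x hx => ?_)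
      nlinarith [hx.1, hx.2, hR.2]
    exact ((h1.mul ((continuousOn_momentDeriv hF1 e).mono hsub)).mul
      ((continuousOn_moment hH1 e).mono hsub)).sub (((continuousOn_moment hF1 e).mono hsub).mul
      (h1.mul ((continuousOn_momentDeriv hH1 e).mono hsub)))
  obtain ⟨c, -, hc⟩ := exists_hasDerivAt_eq_slope W (fun _ => 0) hR.1 hc hd
  have h0 : W 0 = 0 := by simp [hW]
  rw [h0, sub_zero, sub_zero, eq_comm, div_eq_zero_iff] at hc
  have hWR : W R = 0 := hc.resolve_right hR.1.ne'
  have hR1 : 0 < 1 - R ^ 2 := by nlinarith [hR.1, hR.2]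
  have hp : 0 < R ^ 2 * (2 / (1 - R ^ 2)) := mul_pos (pow_pos hR.1 2) (div_pos two_pos hR1)
  have : R ^ 2 * (2 / (1 - R ^ 2)) * (momentDeriv F e R * moment H e R
      - moment F e R * momentDeriv H e R) = 0 := by
    rw [← hWR, hW]; ring
  exact sub_eq_zero.1 ((mul_eq_zero.1 this).resolve_left hp.ne')

/-- The first moments of two harmonic functions are proportional, and the ratio is that of the
directional derivatives at the centre. -/
theorem moment_proportional {F H : E3 → ℝ} (hF : IsBallHarmonic F) (hH : IsBallHarmonic H)
    (e : E3) (h0 : ∀ s ∈ Ioo (0 : ℝ) 1, moment H e s ≠ 0) {R : ℝ} (hR : R ∈ Ioo (0 : ℝ) 1) :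
    fderiv ℝ F 0 e * moment H e R = moment F e R * fderiv ℝ H 0 e := by
  have hF1 : ContDiffOn ℝ 1 F (ball 0 1) := hF.1.of_le (by norm_num)
  have hH1 : ContDiffOn ℝ 1 H (ball 0 1) := hH.1.of_le (by norm_num)
  -- The vanishing Wronskian makes the quotient of the moments constant. The constant is then read
  -- off from their derivatives in the limit `s → 0`.
  have hq : ∀ s ∈ Ioo (0 : ℝ) 1,
      HasDerivAt (fun s => moment F e s / moment H e s) 0 s := fun s hs => by
    refine ((hasDerivAt_moment hF1 e hs).div (hasDerivAt_moment hH1 e hs) (h0 s hs)).congr_deriv ?_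
    rw [moment_wronskian hF hH e hs]
    simp
  have hconst : ∀ s ∈ Ioo (0 : ℝ) 1, moment F e s * moment H e R
      = moment F e R * moment H e s := fun s hs => by
    have := isOpen_Ioo.is_const_of_deriv_eq_zero isPreconnected_Ioo
      (fun x hx => (hq x hx).differentiableAt.differentiableWithinAt)
      (fun x hx => (hq x hx).deriv) hs hR
    rwa [div_eq_div_iff (h0 s hs) (h0 R hR)] at this
  have hder : ∀ s ∈ Ioo (0 : ℝ) 1, momentDeriv F e s * moment H e R
      - moment F e R * momentDeriv H e s = 0 := fun s hs => by
    have h1 := ((hasDerivAt_moment hF1 e hs).mul_const (moment H e R)).sub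
      ((hasDerivAt_moment hH1 e hs).const_mul (moment F e R))
    refine h1.unique ((hasDerivAt_const s (0 : ℝ)).congr_of_eventuallyEq ?_)
    filter_upwards [Ioo_mem_nhds hs.1 hs.2] with t ht
    simp [hconst t ht]
  have hcont : ContinuousAt (fun s => momentDeriv F e s * moment H e R
      - moment F e R * momentDeriv H e s) 0 := by
    have hm : Ioo (-1 : ℝ) 1 ∈ 𝓝 (0 : ℝ) := Ioo_mem_nhds (by norm_num) one_pos
    exact (((continuousOn_momentDeriv hF1 e).continuousAt hm).mul continuousAt_const).sub
      (continuousAt_const.mul ((continuousOn_momentDeriv hH1 e).continuousAt hm))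
  have hlim : Tendsto (fun s => momentDeriv F e s * moment H e R
      - moment F e R * momentDeriv H e s) (𝓝[>] 0) (𝓝 0) := by
    refine tendsto_const_nhds.congr' ?_
    filter_upwards [Ioo_mem_nhdsGT (zero_lt_one' ℝ)] with s hs using (hder s hs).symm
  have := tendsto_nhds_unique (hcont.tendsto.mono_left nhdsWithin_le_nhds) hlim
  rw [momentDeriv_zero, momentDeriv_zero] at this
  have hpi := Real.pi_pos
  have h2 : 4 * Real.pi / 3 * (fderiv ℝ F 0 e * moment H e R - moment F e R * fderiv ℝ H 0 e) = 0 := by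
    linarith
  exact sub_eq_zero.1 ((mul_eq_zero.1 h2).resolve_left (by positivity))

/-! ### Green's identity. -/

/-- Green's identity on centred balls against a harmonic function. -/
theorem IsBallHarmonic.integral_ball_green {F H : E3 → ℝ} (hF : ContDiffOn ℝ 1 F (ball 0 1))
    (hH : IsBallHarmonic H) {R : ℝ} (hR : R ∈ Ioo (0 : ℝ) 1) :
    ∫ x in ball (0 : E3) R, conformalFactor x * ∑ i, partialDeriv i F x * partialDeriv i H x
      = R ^ 2 * (2 / (1 - R ^ 2)) * ∫ ω : sphere (0 : E3) 1,
        F (R • (ω : E3)) * fderiv ℝ H (R • (ω : E3)) ω ∂sphereMeasure := by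
  have hH1 : ContDiffOn ℝ 1 H (ball 0 1) := hH.1.of_le (by norm_num)
  have hW := contDiffOn_conformalFactor_mul hH.1
  have hV : ∀ i, ContDiffOn ℝ 1 (fun x => F x * (conformalFactor x * partialDeriv i H x))
    (ball 0 1) := fun i => hF.mul (hW i)
  have hsub : Icc 0 R ⊆ Ioo (-1 : ℝ) 1 := fun x hx => ⟨by linarith [hx.1], by linarith [hx.2, hR.2]⟩
  have e1 : ∀ x ∈ ball (0 : E3) 1, ∑ i, partialDeriv i (fun x => F x *
      (conformalFactor x * partialDeriv i H x)) x
      = conformalFactor x * ∑ i, partialDeriv i F x * partialDeriv i H x := by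
    intro x hx
    have : ∀ i, partialDeriv i (fun x => F x *
        (conformalFactor x * partialDeriv i H x)) x = F x *
        partialDeriv i (fun y => conformalFactor y * partialDeriv i H y) x
        + partialDeriv i F x * (conformalFactor x * partialDeriv i H x) := fun i => by
      rw [partialDeriv_mul (differentiableAt_of_contDiffOn hF hx)
        (differentiableAt_of_contDiffOn (hW i) hx)]
    simp only [this]
    rw [Finset.sum_add_distrib, ← Finset.mul_sum, hH.2 x hx, Finset.mul_sum, mul_zero, zero_add]
    exact Finset.sum_congr rfl fun i _ => by ring
  have cont : ContinuousOn (fun x => conformalFactor x *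
      ∑ i, partialDeriv i F x * partialDeriv i H x) (ball 0 1) := by
    refine (contDiffOn_conformalFactor (n := 1)).continuousOn.mul (continuousOn_finsetSum _
      fun i _ => ?_)
    exact (continuousOn_fderiv_apply hF _).mul (continuousOn_fderiv_apply hH1 _)
  rw [setIntegral_ball_eq cont hR]
  set Q : ℝ → ℝ := fun s => s ^ 2 * (2 / (1 - s ^ 2)) * ∫ ω : sphere (0 : E3) 1,
        F (s • (ω : E3)) * fderiv ℝ H (s • (ω : E3)) ω ∂sphereMeasure with hQ
  have hd : ∀ s ∈ Ioo 0 R, HasDerivAt Q (s ^ 2 * ∫ ω : sphere (0 : E3) 1,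
      conformalFactor (s • (ω : E3)) * ∑ i, partialDeriv i F (s • (ω : E3)) *
        partialDeriv i H (s • (ω : E3)) ∂sphereMeasure) s := by
    intro s hs
    have h := hasDerivAt_divergence hV ⟨hs.1, hs.2.trans hR.2⟩
    simp only [e1 _ (smul_sphere_mem_ball (hsub ⟨hs.1.le, hs.2.le⟩) _)] at h
    refine h.congr_of_eventuallyEq (Eventually.of_forall fun t => ?_)
    simp only [hQ, mul_assoc]
    rw [← integral_const_mul (2 / (1 - t ^ 2))]
    congr 2
    ext ω
    rw [conformalFactor_smul_sphere, fderiv_eq_sum_partialDeriv]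
    simp only [Fin.sum_univ_three]
    ring
  have hcQ : ContinuousOn Q (Icc 0 R) := by
    have h1 : ContinuousOn (fun s : ℝ => s ^ 2 * (2 / (1 - s ^ 2))) (Icc 0 R) := by
      refine (continuousOn_pow 2).mul (continuousOn_const.div (by fun_prop) fun x hx => ?_)
      nlinarith [hx.1, hx.2, hR.2]
    refine h1.mul (ContinuousOn.mono (continuousOn_sphere_integral
      (K := fun s ω => F (s • (ω : E3)) * fderiv ℝ H (s • (ω : E3)) ω) ?_) hsub)
    exact (continuousOn_comp_smul_sphere hF.continuousOn).mul (continuousOn_radialDeriv hH1)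
  have hci := continuousOn_sphere_integral (K := fun s ω => conformalFactor (s • (ω : E3)) *
    ∑ i, partialDeriv i F (s • (ω : E3)) * partialDeriv i H (s • (ω : E3)))
      (continuousOn_comp_smul_sphere cont)
  rw [intervalIntegral.integral_eq_sub_of_hasDerivAt_of_le hR.1.le hcQ hd
    (ContinuousOn.intervalIntegrable (by
      rw [uIcc_of_le hR.1.le]; exact (continuousOn_pow 2).mul (hci.mono hsub)))]
  simp [hQ]

/-! ### The radial profile of the extremal function. -/

/-- These solve `(2m + 5) c_{m+1} = (2m - 1) c_m`, the recursion that the equation in `profile_ode`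
imposes on power series. -/
noncomputable def profileCoeff (m : ℕ) : ℝ := -4 / ((2 * m - 1) * (2 * m + 1) * (2 * m + 3))

/-- The power series `b` for which `b(‖x‖²) ⟪x, e⟫` is harmonic on the ball. -/
noncomputable def profile : ℝ → ℝ := FormalMultilinearSeries.ofScalarsSum profileCoeff

theorem abs_profileCoeff_le (m : ℕ) : |profileCoeff m| ≤ 4 := by
  have h1 : (1 : ℝ) ≤ |2 * (m : ℝ) - 1| := by
    rcases Nat.eq_zero_or_pos m with rfl | h
    · norm_num
    · have : (1 : ℝ) ≤ m := by exact_mod_cast h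
      rw [abs_of_nonneg (by linarith)]; linarith
  have h2 : (1 : ℝ) ≤ |2 * (m : ℝ) + 1| := by
    rw [abs_of_nonneg (by positivity)]; linarith [m.cast_nonneg (α := ℝ)]
  have h3 : (1 : ℝ) ≤ |2 * (m : ℝ) + 3| := by
    rw [abs_of_nonneg (by positivity)]; linarith [m.cast_nonneg (α := ℝ)]
  rw [profileCoeff, abs_div, abs_mul, abs_mul]
  rw [show |(-4 : ℝ)| = 4 by norm_num]
  exact div_le_self (by norm_num) (one_le_mul_of_one_le_of_one_le
    (one_le_mul_of_one_le_of_one_le h1 h2) h3)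

/-- Bounded coefficients give radius of convergence at least `1`. Defining the profile by its series
makes it smooth across `0`, where the closed form has a removable singularity. -/
theorem analyticOnNhd_profile : AnalyticOnNhd ℝ profile (Ioo (-1) 1) := by
  have hr : (1 : ENNReal) ≤ (FormalMultilinearSeries.ofScalars ℝ profileCoeff).radius := by
    refine FormalMultilinearSeries.le_radius_of_bound _ 4 (r := 1) fun n => ?_
    rw [FormalMultilinearSeries.ofScalars_norm]
    simpa using abs_profileCoeff_le n
  have h := (FormalMultilinearSeries.ofScalars ℝ profileCoeff).hasFPowerSeriesOnBall
    (lt_of_lt_of_le one_pos hr)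
  intro t ht
  refine h.analyticAt_of_mem (Metric.eball_subset_eball hr ?_)
  rw [← ENNReal.ofReal_one, Metric.eball_ofReal]
  simpa [abs_lt] using ht

theorem profile_zero : profile 0 = 4 / 3 := by
  rw [profile, FormalMultilinearSeries.ofScalarsSum_zero]
  norm_num [profileCoeff]

/-- The inverse hyperbolic tangent on `(-1, 1)`. -/
noncomputable def atanh (s : ℝ) : ℝ := (Real.log (1 + s) - Real.log (1 - s)) / 2

theorem hasSum_atanh {s : ℝ} (hs : s ∈ Ioo (0 : ℝ) 1) :
    HasSum (fun k : ℕ => s ^ (2 * k + 1) / (2 * k + 1)) (atanh s) := by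
  have := (Real.hasSum_log_sub_log_of_abs_lt_one (x := s)
    (by rw [abs_of_pos hs.1]; exact hs.2)).div_const 2
  refine this.congr_fun ?_
  intro k
  ring

/-- By partial fractions, `8 / ((2k-1)(2k+1)(2k+3)) = 1/(2k-1) - 2/(2k+1) + 1/(2k+3)`, and each of
the three resulting series is a shift of the series of `atanh`. -/
theorem profile_eq_of_pos {s : ℝ} (hs : s ∈ Ioo (0 : ℝ) 1) :
    2 * s ^ 3 * profile (s ^ 2) = s * (1 + s ^ 2) - (1 - s ^ 2) ^ 2 * atanh s := by
  have h0 := hasSum_atanh hs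
  have h1 : HasSum (fun k : ℕ => s ^ (2 * k + 3) / (2 * k + 3)) (atanh s - s) := by
    have := (hasSum_nat_add_iff' 1).2 h0
    simp only [Finset.sum_range_one] at this
    convert! this using 1
    · ext k; push_cast; ring_nf
    · simp
  have h2 : HasSum (fun k : ℕ => s ^ (2 * k + 3) / (2 * k - 1)) (s ^ 4 * atanh s - s ^ 3) := by
    rw [← hasSum_nat_add_iff' 1]
    have := h0.mul_left (s ^ 4)
    convert! this using 1
    · ext k; push_cast; ring_nf
    · simp; ring
  have h3 := (h2.sub ((h0.mul_left (s ^ 2)).mul_left 2)).add h1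
  have h4 : HasSum (fun k : ℕ => -(2 * s ^ 3 * (profileCoeff k * (s ^ 2) ^ k)))
      (s ^ 4 * atanh s - s ^ 3 - 2 * (s ^ 2 * atanh s) + (atanh s - s)) := by
    refine h3.congr_fun fun k => ?_
    have a1 : (2 * (k : ℝ) - 1) ≠ 0 := by
      intro h
      have : (2 * k : ℝ) = (1 : ℕ) := by push_cast; linarith
      norm_cast at this
      omega
    have a2 : (2 * (k : ℝ) + 1) ≠ 0 := by positivity
    have a3 : (2 * (k : ℝ) + 3) ≠ 0 := by positivity
    have e1 : (s ^ 2) ^ k = s ^ (2 * k) := by rw [pow_mul]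
    rw [e1, pow_add, pow_add, profileCoeff]
    field_simp
    ring
  have h5 := h4.tsum_eq
  rw [tsum_neg, tsum_mul_left] at h5
  have h6 : profile (s ^ 2) = ∑' k : ℕ, profileCoeff k * (s ^ 2) ^ k := by
    rw [profile, FormalMultilinearSeries.ofScalarsSum_eq_tsum]
    simp
  rw [h6]
  linarith

theorem hasDerivAt_atanh {s : ℝ} (hs : s ∈ Ioo (0 : ℝ) 1) :
    HasDerivAt atanh (1 / (1 - s ^ 2)) s := by
  have h1 : 1 + s ≠ 0 := by linarith [hs.1]
  have h2 : 1 - s ≠ 0 := by linarith [hs.2]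
  have h3 : 1 - s ^ 2 ≠ 0 := by
    rw [show 1 - s ^ 2 = (1 + s) * (1 - s) by ring]; exact mul_ne_zero h1 h2
  have := ((((hasDerivAt_id s).const_add 1).log h1).sub
    (((hasDerivAt_id s).const_sub 1).log h2)).div_const 2
  refine this.congr_deriv ?_
  simp only [id]
  rw [show 1 - s ^ 2 = (1 + s) * (1 - s) by ring]
  field_simp
  ring

/-- In the variable `t = s²` the profile and its derivatives are rational in `t` and this one
function, whose derivative is again of that kind; the ODE then becomes a `field_simp` identity. -/
noncomputable def atanhRatio (t : ℝ) : ℝ := atanh √t / √t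

theorem sqrt_mem {t : ℝ} (ht : t ∈ Ioo (0 : ℝ) 1) : √t ∈ Ioo (0 : ℝ) 1 :=
  ⟨Real.sqrt_pos.2 ht.1, by rw [Real.sqrt_lt' one_pos]; simpa using ht.2⟩

theorem hasDerivAt_atanhRatio {t : ℝ} (ht : t ∈ Ioo (0 : ℝ) 1) :
    HasDerivAt atanhRatio ((1 / (1 - t) - atanhRatio t) / (2 * t)) t := by
  have hs := sqrt_mem ht
  have hsq := Real.hasDerivAt_sqrt ht.1.ne'
  have h := ((hasDerivAt_atanh hs).comp t hsq).div hsq hs.1.ne'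
  refine h.congr_deriv ?_
  have e : √t ^ 2 = t := Real.sq_sqrt ht.1.le
  have h1 : 1 - t ≠ 0 := by linarith [ht.2]
  have h2 := hs.1.ne'
  have h3 := ht.1.ne'
  simp only [Function.comp, atanhRatio]
  rw [e]
  field_simp

theorem profile_eq {t : ℝ} (ht : t ∈ Ioo (0 : ℝ) 1) :
    profile t = ((1 + t) - (1 - t) ^ 2 * atanhRatio t) / (2 * t) := by
  have hs := sqrt_mem ht
  have h := profile_eq_of_pos hs
  have e : √t ^ 2 = t := Real.sq_sqrt ht.1.le
  rw [pow_succ, e] at h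
  have h2 := hs.1.ne'
  have h3 := ht.1.ne'
  rw [eq_div_iff (by positivity), atanhRatio]
  field_simp
  linarith

theorem hasDerivAt_profile_explicit {t : ℝ} (ht : t ∈ Ioo (0 : ℝ) 1) :
    HasDerivAt profile (((t - 3) + (1 - t) * (3 + t) * atanhRatio t) / (4 * t ^ 2)) t := by
  have h3 := ht.1.ne'
  have h1 : 1 - t ≠ 0 := by linarith [ht.2]
  have h := (((hasDerivAt_id t).const_add 1).sub ((((hasDerivAt_id t).const_sub 1).pow 2).mul
    (hasDerivAt_atanhRatio ht))).div ((hasDerivAt_id t).const_mul 2) (by simpa using h3)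
  refine (h.congr_of_eventuallyEq ?_).congr_deriv ?_
  · filter_upwards [Ioo_mem_nhds ht.1 ht.2] with x hx
    rw [profile_eq hx]
    simp
  · simp
    field_simp
    ring

theorem hasDerivAt_deriv_profile_explicit {t : ℝ} (ht : t ∈ Ioo (0 : ℝ) 1) :
    HasDerivAt (deriv profile)
      (((15 - t) - (15 - 6 * t - t ^ 2) * atanhRatio t) / (8 * t ^ 3)) t := by
  have h3 := ht.1.ne'
  have h1 : 1 - t ≠ 0 := by linarith [ht.2]
  have h := (((hasDerivAt_id t).sub_const 3).add ((((hasDerivAt_id t).const_sub 1).mul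
    ((hasDerivAt_id t).const_add 3)).mul
    (hasDerivAt_atanhRatio ht))).div ((hasDerivAt_pow 2 t).const_mul 4) (by simpa using h3)
  refine (h.congr_of_eventuallyEq ?_).congr_deriv ?_
  · filter_upwards [Ioo_mem_nhds ht.1 ht.2] with x hx
    rw [(hasDerivAt_profile_explicit hx).deriv]
    simp
  · simp
    field_simp
    ring

/-- The closed forms settle `t > 0`; the centre follows by continuity, as the profile is analytic
there. -/
theorem profile_ode {t : ℝ} (ht : t ∈ Ico (0 : ℝ) 1) :
    (1 - t) * (10 * deriv profile t + 4 * t * deriv (deriv profile) t)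
      + 2 * (profile t + 2 * t * deriv profile t) = 0 := by
  have key : ∀ t ∈ Ioo (0 : ℝ) 1,
      (1 - t) * (10 * deriv profile t + 4 * t * deriv (deriv profile) t)
      + 2 * (profile t + 2 * t * deriv profile t) = 0 := fun t ht => by
    have h3 := ht.1.ne'
    rw [(hasDerivAt_profile_explicit ht).deriv, (hasDerivAt_deriv_profile_explicit ht).deriv,
      profile_eq ht]
    field_simp
    ring
  rcases ht.1.eq_or_lt with h | h
  · subst h
    have c0 := (analyticOnNhd_profile 0 (by simp)).continuousAt
    have c1 := (analyticOnNhd_profile.deriv 0 (by simp)).continuousAt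
    have c2 := (analyticOnNhd_profile.deriv.deriv 0 (by simp)).continuousAt
    have hc : ContinuousAt (fun t : ℝ =>
        (1 - t) * (10 * deriv profile t + 4 * t * deriv (deriv profile) t)
        + 2 * (profile t + 2 * t * deriv profile t)) 0 := by fun_prop
    refine tendsto_nhds_unique (hc.tendsto.mono_left (nhdsWithin_le_nhds (s := Ioi 0))) ?_
    refine tendsto_const_nhds.congr' ?_
    filter_upwards [Ioo_mem_nhdsGT (zero_lt_one' ℝ)] with s hs using (key s hs).symm
  · exact key t ⟨h, ht.2⟩

/-! ### The extremal harmonic function. -/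

/-- The harmonic function on the ball whose restriction to centred spheres is a multiple of
`⟪·, e⟫`. -/
noncomputable def extremal (e x : E3) : ℝ := profile (‖x‖ ^ 2) * inner ℝ x e

/-- The radial derivative of the extremal function on the sphere of radius `s`, divided by
`⟪·, e⟫`. -/
noncomputable def radialSlope (s : ℝ) : ℝ :=
  profile (s ^ 2) + 2 * s ^ 2 * deriv profile (s ^ 2)

theorem normSq_mem {x : E3} (hx : x ∈ ball (0 : E3) 1) : ‖x‖ ^ 2 ∈ Ioo (-1 : ℝ) 1 :=
  ⟨by nlinarith [norm_nonneg x], by linarith [one_sub_norm_sq_pos hx]⟩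

theorem normSq_mem_Ico {x : E3} (hx : x ∈ ball (0 : E3) 1) : ‖x‖ ^ 2 ∈ Ico (0 : ℝ) 1 :=
  ⟨sq_nonneg _, (normSq_mem hx).2⟩

theorem partialDeriv_radial {g : ℝ → ℝ} {g' : ℝ} {x : E3} (hg : HasDerivAt g g' (‖x‖ ^ 2))
    (i : Fin 3) :
    DifferentiableAt ℝ (fun y : E3 => g (‖y‖ ^ 2)) x ∧
      partialDeriv i (fun y : E3 => g (‖y‖ ^ 2)) x = 2 * x i * g' := by
  have h := hg.comp_hasFDerivAt x (hasStrictFDerivAt_norm_sq x).hasFDerivAt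
  refine ⟨h.differentiableAt, ?_⟩
  have : (fun y : E3 => g (‖y‖ ^ 2)) = g ∘ fun y : E3 => ‖y‖ ^ 2 := rfl
  rw [partialDeriv, this, h.fderiv]
  simp only [smul_apply, innerSL_apply_apply, EuclideanSpace.inner_single_right,
    one_mul, conj_trivial, smul_eq_mul, nsmul_eq_mul]
  push_cast
  ring

theorem contDiffOn_extremal (e : E3) : ContDiffOn ℝ 2 (extremal e) (ball 0 1) := by
  have h1 : ContDiffOn ℝ 2 profile (Ioo (-1) 1) :=
    analyticOnNhd_profile.contDiffOn isOpen_Ioo.uniqueDiffOn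
  have h2 : ContDiffOn ℝ 2 (fun x : E3 => profile (‖x‖ ^ 2)) (ball 0 1) :=
    h1.comp (contDiff_norm_sq ℝ).contDiffOn fun x hx => normSq_mem hx
  exact h2.mul (contDiff_id.inner ℝ contDiff_const).contDiffOn

theorem hasDerivAt_profile {t : ℝ} (ht : t ∈ Ioo (-1 : ℝ) 1) :
    HasDerivAt profile (deriv profile t) t :=
  (analyticOnNhd_profile t ht).differentiableAt.hasDerivAt

theorem hasDerivAt_deriv_profile {t : ℝ} (ht : t ∈ Ioo (-1 : ℝ) 1) :
    HasDerivAt (deriv profile) (deriv (deriv profile) t) t :=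
  (analyticOnNhd_profile.deriv t ht).differentiableAt.hasDerivAt

theorem partialDeriv_extremal (e : E3) {x : E3} (hx : x ∈ ball (0 : E3) 1) (i : Fin 3) :
    partialDeriv i (extremal e) x
      = profile (‖x‖ ^ 2) * e i + 2 * x i * deriv profile (‖x‖ ^ 2) * inner ℝ x e := by
  obtain ⟨h1, h2⟩ := partialDeriv_radial (hasDerivAt_profile (normSq_mem hx)) i
  have : extremal e = fun y => profile (‖y‖ ^ 2) * inner ℝ y e := rfl
  rw [this, partialDeriv_mul h1 (differentiableAt_inner_left e x), h2, partialDeriv_inner]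

theorem fderiv_extremal (e : E3) {x : E3} (hx : x ∈ ball (0 : E3) 1) (v : E3) :
    fderiv ℝ (extremal e) x v = profile (‖x‖ ^ 2) * inner ℝ v e
      + 2 * deriv profile (‖x‖ ^ 2) * inner ℝ x e * inner ℝ x v := by
  have h : ∀ a b : E3, inner ℝ a b = ∑ i, a i * b i := fun a b => by
    simp [PiLp.inner_apply, mul_comm]
  rw [fderiv_eq_sum_partialDeriv]
  simp only [partialDeriv_extremal e hx]
  rw [h v e, h x v]
  simp only [Fin.sum_univ_three]
  ring

theorem partialDeriv_congr {F G : E3 → ℝ} {x : E3} (h : F =ᶠ[𝓝 x] G) (i : Fin 3) :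
    partialDeriv i F x = partialDeriv i G x := by
  rw [partialDeriv, partialDeriv, h.fderiv_eq]

theorem isBallHarmonic_extremal (e : E3) : IsBallHarmonic (extremal e) := by
  refine ⟨contDiffOn_extremal e, fun x hx => ?_⟩
  have ht := normSq_mem hx
  have h1t : 1 - ‖x‖ ^ 2 ≠ 0 := (one_sub_norm_sq_pos hx).ne'
  have dk : HasDerivAt (fun t : ℝ => 2 / (1 - t) * profile t)
      (2 / (1 - ‖x‖ ^ 2) ^ 2 * profile (‖x‖ ^ 2)
        + 2 / (1 - ‖x‖ ^ 2) * deriv profile (‖x‖ ^ 2)) (‖x‖ ^ 2) := by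
    have := ((hasDerivAt_const (‖x‖ ^ 2) (2 : ℝ)).div ((hasDerivAt_id (‖x‖ ^ 2)).const_sub 1)
      h1t).mul (hasDerivAt_profile ht)
    refine this.congr_deriv ?_
    simp
  have dl : HasDerivAt (fun t : ℝ => 2 / (1 - t) * (2 * deriv profile t))
      (2 / (1 - ‖x‖ ^ 2) ^ 2 * (2 * deriv profile (‖x‖ ^ 2))
        + 2 / (1 - ‖x‖ ^ 2) * (2 * deriv (deriv profile) (‖x‖ ^ 2))) (‖x‖ ^ 2) := by
    have := ((hasDerivAt_const (‖x‖ ^ 2) (2 : ℝ)).div ((hasDerivAt_id (‖x‖ ^ 2)).const_sub 1)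
      h1t).mul ((hasDerivAt_deriv_profile ht).const_mul 2)
    refine this.congr_deriv ?_
    simp
  have key : ∀ i, partialDeriv i (fun y => conformalFactor y * partialDeriv i (extremal e) y) x
      = 2 * x i * e i * (2 / (1 - ‖x‖ ^ 2) ^ 2 * profile (‖x‖ ^ 2)
        + 2 / (1 - ‖x‖ ^ 2) * deriv profile (‖x‖ ^ 2))
        + 2 * (x i * x i) * inner ℝ x e * (2 / (1 - ‖x‖ ^ 2) ^ 2 * (2 * deriv profile (‖x‖ ^ 2))
        + 2 / (1 - ‖x‖ ^ 2) * (2 * deriv (deriv profile) (‖x‖ ^ 2)))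
        + 2 / (1 - ‖x‖ ^ 2) * (2 * deriv profile (‖x‖ ^ 2)) * (inner ℝ x e + x i * e i) := by
    intro i
    obtain ⟨dk1, dk2⟩ := partialDeriv_radial dk i
    obtain ⟨dl1, dl2⟩ := partialDeriv_radial dl i
    have hc : DifferentiableAt ℝ (fun y : E3 => y i) x := by fun_prop
    have hci : DifferentiableAt ℝ (fun y : E3 => y i * inner ℝ y e) x :=
      hc.mul (differentiableAt_inner_left e x)
    -- Each component of `λ ∇H` is written with two radial coefficients, so only one-variable
    -- derivatives in `t = ‖y‖²` are needed.
    have he : (fun y => conformalFactor y * partialDeriv i (extremal e) y) =ᶠ[𝓝 x]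
        fun y => (2 / (1 - ‖y‖ ^ 2) * profile (‖y‖ ^ 2)) * e i +
          (2 / (1 - ‖y‖ ^ 2) * (2 * deriv profile (‖y‖ ^ 2))) * (y i * inner ℝ y e) := by
      filter_upwards [isOpen_ball.mem_nhds hx] with y hy
      rw [partialDeriv_extremal e hy, conformalFactor]
      ring
    have hadd : ∀ {F G : E3 → ℝ}, DifferentiableAt ℝ F x → DifferentiableAt ℝ G x →
        partialDeriv i (fun y => F y + G y) x = partialDeriv i F x + partialDeriv i G x := by
      intro F G hF hG
      rw [partialDeriv, fderiv_fun_add hF hG]; rfl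
    have hconst : partialDeriv i (fun _ : E3 => e i) x = 0 := by simp [partialDeriv]
    rw [partialDeriv_congr he, hadd (dk1.mul_const _) (dl1.fun_mul hci),
      partialDeriv_mul dk1 (differentiableAt_const _), partialDeriv_mul dl1 hci,
      partialDeriv_mul hc (differentiableAt_inner_left e x), partialDeriv_coord,
      partialDeriv_inner, hconst, dk2, dl2]
    ring
  simp only [key]
  have hin : inner ℝ x e = x 0 * e 0 + x 1 * e 1 + x 2 * e 2 := by
    simp [PiLp.inner_apply, Fin.sum_univ_three, mul_comm]
  have hn : ‖x‖ ^ 2 = x 0 * x 0 + x 1 * x 1 + x 2 * x 2 := by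
    rw [EuclideanSpace.real_norm_sq_eq, Fin.sum_univ_three]; ring
  have ode := profile_ode (normSq_mem_Ico hx)
  set p := profile (‖x‖ ^ 2)
  set q := deriv profile (‖x‖ ^ 2)
  set r := deriv (deriv profile) (‖x‖ ^ 2)
  have expand : ∀ A B t : ℝ, t = x 0 * x 0 + x 1 * x 1 + x 2 * x 2 →
      ∑ i, (2 * x i * e i * (A * p + B * q)
        + 2 * (x i * x i) * inner ℝ x e * (A * (2 * q) + B * (2 * r))
        + B * (2 * q) * (inner ℝ x e + x i * e i))
      = inner ℝ x e * (2 * (A * p + B * q)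
        + 2 * t * (A * (2 * q) + B * (2 * r)) + B * (2 * q) * 4) := by
    intro A B t ht
    rw [ht, Fin.sum_univ_three]
    linear_combination (-(2 * (A * p + B * q)) - B * (2 * q)) * hin
  rw [expand _ _ _ hn]
  generalize ‖x‖ ^ 2 = t at *
  -- The divergence is `⟪x, e⟫` times a multiple of the left side of `profile_ode`.
  have : 2 * (2 / (1 - t) ^ 2 * p + 2 / (1 - t) * q)
        + 2 * t * (2 / (1 - t) ^ 2 * (2 * q) + 2 / (1 - t) * (2 * r))
        + 2 / (1 - t) * (2 * q) * 4
      = 2 / (1 - t) ^ 2 * ((1 - t) * (10 * q + 4 * t * r) + 2 * (p + 2 * t * q)) := by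
    field_simp
    ring
  rw [this, ode]
  ring

theorem fderiv_extremal_radial (e : E3) {s : ℝ} (hs : s ∈ Ioo (-1 : ℝ) 1)
    (ω : sphere (0 : E3) 1) :
    fderiv ℝ (extremal e) (s • (ω : E3)) ω = radialSlope s * inner ℝ (ω : E3) e := by
  rw [fderiv_extremal e (smul_sphere_mem_ball hs ω), norm_smul, real_inner_smul_left,
    real_inner_smul_left, real_inner_self_eq_norm_sq]
  simp only [norm_eq_of_mem_sphere, mul_one, Real.norm_eq_abs, sq_abs, radialSlope]
  ring

theorem moment_extremal (e : E3) (s : ℝ) :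
    moment (extremal e) e s = 4 * Real.pi / 3 * (s * profile (s ^ 2)) * ‖e‖ ^ 2 := by
  have h : ∀ ω : sphere (0 : E3) 1, extremal e (s • (ω : E3)) * inner ℝ (ω : E3) e
      = (s * profile (s ^ 2)) * (innerSL ℝ e (ω : E3) * inner ℝ (ω : E3) e) := fun ω => by
    rw [extremal, norm_smul, real_inner_smul_left, innerSL_apply_apply, real_inner_comm e]
    simp only [norm_eq_of_mem_sphere, mul_one, Real.norm_eq_abs, sq_abs]
    ring
  simp only [moment, h, integral_const_mul]
  rw [integral_sphere_linear_mul_inner, innerSL_apply_apply, real_inner_self_eq_norm_sq]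
  ring

theorem fderiv_extremal_zero (e v : E3) :
    fderiv ℝ (extremal e) 0 v = 4 / 3 * inner ℝ v e := by
  rw [fderiv_extremal e (by simp)]
  simp [profile_zero]

/-! ### The sharp energy inequality at the centre. -/

/-- A quarter of the constant `ν`, as a function of the Euclidean radius. -/
noncomputable def energyConst (R : ℝ) : ℝ :=
  3 * Real.pi / 4 * (R ^ 2 * (2 / (1 - R ^ 2)) * (R * profile (R ^ 2)) * radialSlope R)

/-- Pairing of a function with an extremal function over a centred ball. -/
theorem integral_ball_extremal {F : E3 → ℝ} (hF : ContDiffOn ℝ 1 F (ball 0 1)) (e : E3) {R : ℝ}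
    (hR : R ∈ Ioo (0 : ℝ) 1) :
    ∫ x in ball (0 : E3) R, conformalFactor x *
        ∑ i, partialDeriv i F x * partialDeriv i (extremal e) x
      = R ^ 2 * (2 / (1 - R ^ 2)) * radialSlope R * moment F e R := by
  rw [IsBallHarmonic.integral_ball_green hF (isBallHarmonic_extremal e) hR]
  have h : ∀ ω : sphere (0 : E3) 1, F (R • (ω : E3)) * fderiv ℝ (extremal e) (R • (ω : E3)) ω
      = radialSlope R * (F (R • (ω : E3)) * inner ℝ (ω : E3) e) := fun ω => by
    rw [fderiv_extremal_radial e (Ioo_zero_one_subset hR)]; ring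
  simp only [h, integral_const_mul, moment]
  ring

theorem energy_extremal (e : E3) {R : ℝ} (hR : R ∈ Ioo (0 : ℝ) 1) :
    ∫ x in ball (0 : E3) R, conformalFactor x * ∑ i, partialDeriv i (extremal e) x ^ 2
      = energyConst R * (16 / 9 * ‖e‖ ^ 2) := by
  have h := integral_ball_extremal ((contDiffOn_extremal e).of_le (by norm_num)) e hR
  simp only [← pow_two] at h
  rw [h, moment_extremal, energyConst]
  ring

theorem continuousOn_energyDensity {F G : E3 → ℝ} (hF : ContDiffOn ℝ 1 F (ball 0 1))
    (hG : ContDiffOn ℝ 1 G (ball 0 1)) :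
    ContinuousOn (fun x => conformalFactor x * ∑ i, partialDeriv i F x * partialDeriv i G x)
      (ball 0 1) := by
  refine (contDiffOn_conformalFactor (n := 1)).continuousOn.mul (continuousOn_finsetSum _
    fun i _ => ?_)
  exact (continuousOn_fderiv_apply hF _).mul (continuousOn_fderiv_apply hG _)

theorem integrableOn_energyDensity {F G : E3 → ℝ} (hF : ContDiffOn ℝ 1 F (ball 0 1))
    (hG : ContDiffOn ℝ 1 G (ball 0 1)) {R : ℝ} (hR : R < 1) :
    IntegrableOn (fun x => conformalFactor x * ∑ i, partialDeriv i F x * partialDeriv i G x)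
      (ball 0 R) :=
  (((continuousOn_energyDensity hF hG).mono (closedBall_subset_ball hR)).integrableOn_compact
      (isCompact_closedBall _ _)).mono_set ball_subset_closedBall

/-- No estimate of the closed form is needed: up to a positive factor the constant is the energy of
an extremal function whose gradient is nonzero at the centre. -/
theorem energyConst_pos {R : ℝ} (hR : R ∈ Ioo (0 : ℝ) 1) : 0 < energyConst R := by
  set e : E3 := EuclideanSpace.single 0 1 with he
  have hC : ContDiffOn ℝ 1 (extremal e) (ball 0 1) := (contDiffOn_extremal e).of_le (by norm_num)
  have hsub : ball (0 : E3) R ⊆ ball 0 1 := ball_subset_ball hR.2.le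
  set G : E3 → ℝ := fun x => conformalFactor x *
    ∑ i, partialDeriv i (extremal e) x * partialDeriv i (extremal e) x with hG
  have hpos : 0 < ∫ x in ball (0 : E3) R, G x := by
    rw [setIntegral_pos_iff_support_of_nonneg_ae _ (integrableOn_energyDensity hC hC hR.2)]
    · have ho : IsOpen (ball (0 : E3) R ∩ G ⁻¹' Ioi 0) :=
        ((continuousOn_energyDensity hC hC).mono hsub).isOpen_inter_preimage isOpen_ball isOpen_Ioi
      refine (ho.measure_pos volume ⟨0, by simpa using hR.1, ?_⟩).trans_le
        (measure_mono fun x hx => ⟨ne_of_gt hx.2, hx.1⟩)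
      have h0 : ∀ i, partialDeriv i (extremal e) 0 = 4 / 3 * e i := fun i => by
        rw [partialDeriv_extremal e (by simp)]; simp [profile_zero]
      simp only [hG, mem_preimage, mem_Ioi, h0]
      refine mul_pos (conformalFactor_pos (by simp)) ?_
      simp [he]
    · filter_upwards [ae_restrict_mem measurableSet_ball] with x hx
      exact mul_nonneg (conformalFactor_pos (hsub hx)).le
        (Finset.sum_nonneg fun i _ => mul_self_nonneg _)
  have h := energy_extremal e hR
  simp only [pow_two (partialDeriv _ _ _)] at h
  rw [h] at hpos
  simpa [he] using hpos

/-- The profile value is a factor of the positive constant `energyConst R`, so it cannot vanish. -/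
theorem moment_extremal_ne_zero {e : E3} (he : e ≠ 0) {R : ℝ} (hR : R ∈ Ioo (0 : ℝ) 1) :
    moment (extremal e) e R ≠ 0 := by
  have h := (energyConst_pos hR).ne'
  rw [energyConst] at h
  rw [moment_extremal]
  have h1 : R * profile (R ^ 2) ≠ 0 := fun h0 => h (by rw [h0]; ring)
  have := Real.pi_pos
  have h2 : ‖e‖ ≠ 0 := norm_ne_zero_iff.2 he
  positivity

/-- The energy of a harmonic function on a centred ball is bounded below by its gradient at the
centre. -/
theorem IsBallHarmonic.energy_ge {F : E3 → ℝ} (hF : IsBallHarmonic F) {R : ℝ}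
    (hR : R ∈ Ioo (0 : ℝ) 1) :
    energyConst R * ∑ i, partialDeriv i F 0 ^ 2
      ≤ ∫ x in ball (0 : E3) R, conformalFactor x * ∑ i, partialDeriv i F x ^ 2 := by
  have hF1 : ContDiffOn ℝ 1 F (ball 0 1) := hF.1.of_le (by norm_num)
  -- The direction of the comparison function is the gradient of `F` at the centre.
  set e : E3 := WithLp.toLp 2 fun i => partialDeriv i F 0 with he
  have hei : ∀ i, e i = partialDeriv i F 0 := fun i => rfl
  have hee : ‖e‖ ^ 2 = ∑ i, partialDeriv i F 0 ^ 2 := by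
    rw [EuclideanSpace.real_norm_sq_eq]
  have hH1 : ContDiffOn ℝ 1 (extremal e) (ball 0 1) := (contDiffOn_extremal e).of_le (by norm_num)
  have hX : ∫ x in ball (0 : E3) R, conformalFactor x *
        ∑ i, partialDeriv i F x * partialDeriv i (extremal e) x
      = 4 / 3 * energyConst R * ‖e‖ ^ 2 := by
    rw [integral_ball_extremal hF1 e hR]
    by_cases h0 : e = 0
    · rw [h0]; simp [moment]
    have hprop := moment_proportional hF (isBallHarmonic_extremal e) e
      (fun s hs => moment_extremal_ne_zero h0 hs) hR
    have hFe : fderiv ℝ F 0 e = ‖e‖ ^ 2 := by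
      rw [fderiv_eq_sum_partialDeriv, hee]
      exact Finset.sum_congr rfl fun i _ => by rw [hei]; ring
    rw [hFe, fderiv_extremal_zero, real_inner_self_eq_norm_sq, moment_extremal] at hprop
    have hne : ‖e‖ ^ 2 ≠ 0 := pow_ne_zero _ (norm_ne_zero_iff.2 h0)
    have hm : moment F e R = Real.pi * (R * profile (R ^ 2)) * ‖e‖ ^ 2 := by
      have : ‖e‖ ^ 2 * (4 / 3 * (Real.pi * (R * profile (R ^ 2)) * ‖e‖ ^ 2 - moment F e R)) = 0 := by
        linarith
      linarith [(mul_eq_zero.1 this).resolve_left hne]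
    rw [hm, energyConst]
    ring
  have hHH := energy_extremal e hR
  have iF := integrableOn_energyDensity hF1 hF1 hR.2
  have iX := integrableOn_energyDensity hF1 hH1 hR.2
  have iH := integrableOn_energyDensity hH1 hH1 hR.2
  have hsub : ball (0 : E3) R ⊆ ball 0 1 := ball_subset_ball hR.2.le
  -- Since `profile 0 = 4/3`, the factor `3/4` matches the gradients at the centre; `3/4 • extremal
  -- e` is then the energy projection of `F`.
  have hnn : 0 ≤ ∫ x in ball (0 : E3) R, conformalFactor x *
      ∑ i, (partialDeriv i F x - 3 / 4 * partialDeriv i (extremal e) x) ^ 2 :=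
    setIntegral_nonneg measurableSet_ball fun x hx =>
      mul_nonneg (conformalFactor_pos (hsub hx)).le (Finset.sum_nonneg fun i _ => sq_nonneg _)
  have hexp : ∫ x in ball (0 : E3) R, conformalFactor x *
      ∑ i, (partialDeriv i F x - 3 / 4 * partialDeriv i (extremal e) x) ^ 2
      = (∫ x in ball (0 : E3) R, conformalFactor x *
          ∑ i, partialDeriv i F x * partialDeriv i F x)
        - 3 / 2 * (∫ x in ball (0 : E3) R, conformalFactor x *
          ∑ i, partialDeriv i F x * partialDeriv i (extremal e) x)
        + 9 / 16 * (∫ x in ball (0 : E3) R, conformalFactor x *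
          ∑ i, partialDeriv i (extremal e) x * partialDeriv i (extremal e) x) := by
    rw [← integral_const_mul, ← integral_const_mul, ← integral_sub iF (iX.const_mul _),
      ← integral_add (iF.fun_sub (iX.const_mul _)) (iH.const_mul _)]
    congr 1
    ext x
    simp only [Fin.sum_univ_three]
    ring
  simp only [pow_two (partialDeriv _ _ _)] at hHH hee ⊢
  rw [hexp, hX, hHH] at hnn
  rw [← hee]
  linarith

/-- The constant `ν` in terms of the Euclidean radius `tanh (r / 2)`. -/
theorem nu_eq {r : ℝ} (hr : 0 < r) : nu r = 4 * energyConst (Real.tanh (r / 2)) := by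
  set R := Real.tanh (r / 2) with hRdef
  have hr2 : 0 < r / 2 := by linarith
  have hsh : 0 < Real.sinh (r / 2) := Real.sinh_pos_iff.2 hr2
  have hch : 0 < Real.cosh (r / 2) := Real.cosh_pos _
  have hR : R ∈ Ioo (0 : ℝ) 1 :=
    ⟨by rw [hRdef, Real.tanh_eq_sinh_div_cosh]; positivity, Real.tanh_lt_one _⟩
  -- This is how the bare `r` enters `ν`; the hyperbolic functions of `r` become rational in `R`.
  have hat : atanh R = r / 2 := by
    have h := Real.artanh_tanh (r / 2)
    rw [← hRdef, Real.artanh_eq_half_log ⟨by linarith [hR.1], hR.2.le⟩,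
      Real.log_div (by linarith [hR.1]) (by linarith [hR.2])] at h
    rw [atanh]; linarith
  have h1 : 1 - R ^ 2 ≠ 0 := by nlinarith [hR.1, hR.2]
  have hR0 := hR.1.ne'
  have hcs := Real.cosh_sq (r / 2)
  have hRs : Real.sinh (r / 2) = R * Real.cosh (r / 2) := by
    rw [hRdef, Real.tanh_eq_sinh_div_cosh]; field_simp
  have hc2 : Real.cosh (r / 2) ^ 2 * (1 - R ^ 2) = 1 := by
    rw [hRs] at hcs; linarith
  have hc2' : Real.cosh (r / 2) ^ 2 = 1 / (1 - R ^ 2) := by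
    rw [eq_div_iff h1]; exact hc2
  have hsr : Real.sinh r = 2 * R / (1 - R ^ 2) := by
    rw [show r = 2 * (r / 2) by ring, Real.sinh_two_mul, hRs]
    rw [show 2 * (R * Real.cosh (r / 2)) * Real.cosh (r / 2) = 2 * R * Real.cosh (r / 2) ^ 2 by ring,
      hc2']
    ring
  have hcr : Real.cosh r = (1 + R ^ 2) / (1 - R ^ 2) := by
    rw [show r = 2 * (r / 2) by ring, Real.cosh_two_mul, hRs]
    rw [show Real.cosh (r / 2) ^ 2 + (R * Real.cosh (r / 2)) ^ 2
      = (1 + R ^ 2) * Real.cosh (r / 2) ^ 2 by ring, hc2']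
    ring
  have hRt : R ^ 2 ∈ Ioo (0 : ℝ) 1 := ⟨by have := hR.1; positivity, by nlinarith [hR.1, hR.2]⟩
  have har : atanhRatio (R ^ 2) = r / (2 * R) := by
    rw [atanhRatio, Real.sqrt_sq hR.1.le, hat]; field_simp
  rw [nu, energyConst, radialSlope, (hasDerivAt_profile_explicit hRt).deriv, profile_eq hRt, har,
    hsr, hcr]
  have h2 : 1 + R ^ 2 ≠ 0 := by positivity
  clear_value R
  field_simp
  ring

/-! ### Isometric involutions and invariance of the energy. -/

/-- An involutive isometry of the Poincare ball: a `C²` involution whose derivative is a multiple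
of a linear isometry, with the ratio of the conformal factors as the multiplier. -/
structure IsBallInvolution (T : E3 → E3) : Prop where
  mapsTo : MapsTo T (ball 0 1) (ball 0 1)
  invol : ∀ x ∈ ball (0 : E3) 1, T (T x) = x
  contDiffOn : ContDiffOn ℝ 2 T (ball 0 1)
  conformal : ∀ x ∈ ball (0 : E3) 1, ∃ S : E3 ≃ₗᵢ[ℝ] E3,
    HasFDerivAt T ((conformalFactor x / conformalFactor (T x)) • (S : E3 →L[ℝ] E3)) x
  dist_sq : ∀ x ∈ ball (0 : E3) 1, ∀ y ∈ ball (0 : E3) 1,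
    ‖T x - T y‖ ^ 2 = (1 - ‖T x‖ ^ 2) / (1 - ‖x‖ ^ 2) * ((1 - ‖T y‖ ^ 2) / (1 - ‖y‖ ^ 2))
      * ‖x - y‖ ^ 2

theorem isBallInvolution_id : IsBallInvolution id where
  mapsTo := mapsTo_id _
  invol _ _ := rfl
  contDiffOn := contDiffOn_id
  conformal x hx := by
    refine ⟨LinearIsometryEquiv.refl ℝ E3, ?_⟩
    rw [id, div_self (conformalFactor_pos hx).ne', one_smul]
    exact hasFDerivAt_id x
  dist_sq x hx y hy := by
    rw [id, id, div_self (one_sub_norm_sq_pos hx).ne', div_self (one_sub_norm_sq_pos hy).ne']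
    ring

/-- The relation on `a` and `ρ` says that the inversion sphere meets the unit sphere orthogonally,
which is why the inversion preserves the ball and scales `1 - ‖x‖²` by its own conformal factor. -/
theorem one_sub_norm_inversion_sq {a x : E3} {ρ : ℝ} (ha : ‖a‖ ^ 2 = 1 + ρ ^ 2) (hx : x ≠ a) :
    1 - ‖EuclideanGeometry.inversion a ρ x‖ ^ 2 = (ρ / dist x a) ^ 2 * (1 - ‖x‖ ^ 2) := by
  have h0 : dist x a ≠ 0 := dist_ne_zero.2 hx
  have hd : dist x a ^ 2 = ‖x‖ ^ 2 - 2 * inner ℝ x a + ‖a‖ ^ 2 := by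
    rw [dist_eq_norm, norm_sub_sq_real]
  set k := (ρ / dist x a) ^ 2 with hk
  have hkd : k * dist x a ^ 2 = ρ ^ 2 := by rw [hk]; field_simp
  have : EuclideanGeometry.inversion a ρ x = k • (x - a) + a := rfl
  rw [this, norm_add_sq_real, norm_smul, mul_pow, Real.norm_eq_abs, sq_abs, real_inner_smul_left,
    inner_sub_left, real_inner_self_eq_norm_sq, norm_sub_sq_real, ← hd, ha]
  rw [hd, ha] at hkd
  rw [hd, ha]
  clear_value k
  linear_combination (-k + 1) * hkd

/-- For every point of the ball there is an involutive isometry that exchanges it with the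
centre. -/
theorem exists_isBallInvolution {p : E3} (hp : p ∈ ball (0 : E3) 1) :
    ∃ T, IsBallInvolution T ∧ T 0 = p := by
  rcases eq_or_ne p 0 with rfl | hp0
  · exact ⟨id, isBallInvolution_id, rfl⟩
  have hn0 : 0 < ‖p‖ := norm_pos_iff.2 hp0
  have hn1 : ‖p‖ < 1 := by simpa using hp
  -- The centre is the inverse of `p` in the unit sphere; with the orthogonal radius `ρ`, inversion
  -- exchanges `0` and `p`. It escapes to infinity for `p = 0`, whence the separate case.
  set a : E3 := (‖p‖ ^ 2)⁻¹ • p with ha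
  have hna : ‖a‖ = ‖p‖⁻¹ := by
    rw [ha, norm_smul, norm_inv, norm_pow, norm_norm]; field_simp
  have hna1 : 1 < ‖a‖ := by rw [hna]; exact (one_lt_inv₀ hn0).2 hn1
  set ρ := √(‖a‖ ^ 2 - 1) with hρ
  have hρ2 : ρ ^ 2 = ‖a‖ ^ 2 - 1 := Real.sq_sqrt (by nlinarith)
  have hρ0 : ρ ≠ 0 := (Real.sqrt_pos.2 (by nlinarith)).ne'
  have haρ : ‖a‖ ^ 2 = 1 + ρ ^ 2 := by linarith
  have hne : ∀ x ∈ ball (0 : E3) 1, x ≠ a := fun x hx h => by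
    rw [h] at hx
    have : ‖a‖ < 1 := by simpa using hx
    linarith
  have hdist : ∀ x ∈ ball (0 : E3) 1, 0 < dist x a := fun x hx => dist_pos.2 (hne x hx)
  have hfac : ∀ x ∈ ball (0 : E3) 1, 1 - ‖EuclideanGeometry.inversion a ρ x‖ ^ 2
      = (ρ / dist x a) ^ 2 * (1 - ‖x‖ ^ 2) := fun x hx => one_sub_norm_inversion_sq haρ (hne x hx)
  have hmaps : MapsTo (EuclideanGeometry.inversion a ρ) (ball 0 1) (ball 0 1) := fun x hx => by
    have h1 : 0 < 1 - ‖EuclideanGeometry.inversion a ρ x‖ ^ 2 := by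
      rw [hfac x hx]
      have := hdist x hx
      exact mul_pos (by positivity) (one_sub_norm_sq_pos hx)
    rw [mem_ball_zero_iff]
    nlinarith [norm_nonneg (EuclideanGeometry.inversion a ρ x)]
  refine ⟨EuclideanGeometry.inversion a ρ, ⟨hmaps,
    fun x _ => EuclideanGeometry.inversion_inversion a hρ0 x,
    contDiffOn_const.inversion contDiffOn_const contDiffOn_id hne, fun x hx => ?_,
    fun x hx y hy => ?_⟩, ?_⟩
  · refine ⟨(ℝ ∙ (x - a))ᗮ.reflection, ?_⟩
    have h : conformalFactor x / conformalFactor (EuclideanGeometry.inversion a ρ x)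
        = (ρ / dist x a) ^ 2 := by
      have h1 := one_sub_norm_sq_pos hx
      have := hdist x hx
      rw [conformalFactor, conformalFactor, hfac x hx]
      field_simp
    rw [h]
    exact EuclideanGeometry.hasFDerivAt_inversion (hne x hx)
  · have h1 := one_sub_norm_sq_pos hx
    have h2 := one_sub_norm_sq_pos hy
    have h3 := hdist x hx
    have h4 := hdist y hy
    rw [hfac x hx, hfac y hy, ← dist_eq_norm, EuclideanGeometry.dist_inversion_inversion
      (hne x hx) (hne y hy), dist_eq_norm x y]
    field_simp
  · have h : EuclideanGeometry.inversion a ρ 0 = (ρ / dist 0 a) ^ 2 • (0 - a) + a := rfl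
    rw [h, dist_zero_left, div_pow, hρ2, hna, ha, zero_sub, smul_neg, smul_smul, ← sub_eq_neg_add,
      ← sub_smul]
    have : (‖p‖ ^ 2)⁻¹ - (‖p‖⁻¹ ^ 2 - 1) / ‖p‖⁻¹ ^ 2 * (‖p‖ ^ 2)⁻¹ = 1 := by
      field_simp
      ring
    rw [this, one_smul]

namespace IsBallInvolution

variable {T : E3 → E3}

theorem differentiableAt (hT : IsBallInvolution T) {x : E3} (hx : x ∈ ball (0 : E3) 1) :
    DifferentiableAt ℝ T x :=
  (hT.contDiffOn.differentiableOn two_ne_zero).differentiableAt (isOpen_ball.mem_nhds hx)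

theorem injOn (hT : IsBallInvolution T) : InjOn T (ball 0 1) := fun x hx y hy h => by
  rw [← hT.invol x hx, ← hT.invol y hy, h]

theorem image_ball (hT : IsBallInvolution T) : T '' ball 0 1 = ball 0 1 :=
  Subset.antisymm hT.mapsTo.image_subset fun x hx => ⟨T x, hT.mapsTo hx, hT.invol x hx⟩

theorem contDiffOn_comp (hT : IsBallInvolution T) {n : WithTop ℕ∞} (hn : n ≤ 2) {F : E3 → ℝ}
    (hF : ContDiffOn ℝ n F (ball 0 1)) : ContDiffOn ℝ n (F ∘ T) (ball 0 1) :=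
  hF.comp (hT.contDiffOn.of_le hn) hT.mapsTo

/-- The dual metric is preserved by an isometry. -/
theorem sum_partialDeriv_comp (hT : IsBallInvolution T) {F G : E3 → ℝ} {x : E3}
    (hx : x ∈ ball (0 : E3) 1) (hF : DifferentiableAt ℝ F (T x))
    (hG : DifferentiableAt ℝ G (T x)) :
    ∑ i, partialDeriv i (F ∘ T) x * partialDeriv i (G ∘ T) x
      = (conformalFactor x / conformalFactor (T x)) ^ 2 *
        ∑ i, partialDeriv i F (T x) * partialDeriv i G (T x) := by
  obtain ⟨S, hS⟩ := hT.conformal x hx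
  set k := conformalFactor x / conformalFactor (T x)
  have grad : ∀ H : E3 → ℝ, ∃ g : E3, ∀ v, fderiv ℝ H (T x) v = inner ℝ g v := fun H =>
    ⟨(InnerProductSpace.toDual ℝ E3).symm (fderiv ℝ H (T x)), fun v => by simp⟩
  have sums : ∀ g h : E3, ∑ i, (inner ℝ g (EuclideanSpace.single i (1 : ℝ)) : ℝ) *
      inner ℝ h (EuclideanSpace.single i (1 : ℝ)) = inner ℝ g h := fun g h => by
    simp only [EuclideanSpace.inner_single_right, one_mul, conj_trivial]
    simp [PiLp.inner_apply, mul_comm]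
  have pd : ∀ H : E3 → ℝ, DifferentiableAt ℝ H (T x) → ∀ g : E3,
      (∀ v, fderiv ℝ H (T x) v = inner ℝ g v) → ∀ i, partialDeriv i (H ∘ T) x
        = k * inner ℝ (S.symm g) (EuclideanSpace.single i (1 : ℝ)) := by
    intro H hH g hg i
    rw [partialDeriv, (hH.hasFDerivAt.comp x hS).fderiv]
    have : inner ℝ (S.symm g) (EuclideanSpace.single i (1 : ℝ))
        = inner ℝ g (S (EuclideanSpace.single i (1 : ℝ))) := by
      rw [← S.inner_map_map, S.apply_symm_apply]
    rw [this]
    simp [hg]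
  obtain ⟨gF, hgF⟩ := grad F
  obtain ⟨gG, hgG⟩ := grad G
  simp only [pd F hF gF hgF, pd G hG gG hgG]
  have e : ∀ i, partialDeriv i F (T x) * partialDeriv i G (T x)
      = inner ℝ gF (EuclideanSpace.single i (1 : ℝ)) *
        inner ℝ gG (EuclideanSpace.single i (1 : ℝ)) := fun i => by
    rw [partialDeriv, partialDeriv, hgF, hgG]
  simp only [e]
  rw [sums, ← S.symm.inner_map_map gF gG, ← sums (S.symm gF) (S.symm gG), Finset.mul_sum]
  exact Finset.sum_congr rfl fun i _ => by ring

/-- The unit ball is mapped onto itself, so its finite nonzero volume is scaled by `1`. -/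
theorem abs_det_linearIsometryEquiv (S : E3 ≃ₗᵢ[ℝ] E3) :
    |(S : E3 →L[ℝ] E3).det| = 1 := by
  have h := Measure.addHaar_image_continuousLinearMap (volume : Measure E3) (S : E3 →L[ℝ] E3)
    (ball 0 1)
  have himg : (S : E3 →L[ℝ] E3) '' ball 0 1 = ball 0 1 := by
    have := S.image_ball 0 1
    rw [map_zero] at this
    exact this
  rw [himg] at h
  have hpos : volume (ball (0 : E3) 1) ≠ 0 := (measure_ball_pos _ _ one_pos).ne'
  have hfin : volume (ball (0 : E3) 1) ≠ ⊤ := measure_ball_lt_top.ne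
  have h1 : ENNReal.ofReal |(S : E3 →L[ℝ] E3).det| = 1 := by
    have := (ENNReal.mul_eq_right hpos hfin).1 h.symm
    exact this
  simpa using h1

/-- The Dirichlet pairing is preserved by an isometry. -/
theorem setIntegral_image (hT : IsBallInvolution T) {F G : E3 → ℝ}
    (hF : ContDiffOn ℝ 1 F (ball 0 1)) (hG : ContDiffOn ℝ 1 G (ball 0 1)) {s : Set E3}
    (hs : MeasurableSet s) (hsb : s ⊆ ball 0 1) :
    ∫ x in T '' s, conformalFactor x * ∑ i, partialDeriv i F x * partialDeriv i G x
      = ∫ x in s, conformalFactor x *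
        ∑ i, partialDeriv i (F ∘ T) x * partialDeriv i (G ∘ T) x := by
  rw [integral_image_eq_integral_abs_det_fderiv_smul volume hs (f' := fderiv ℝ T)
    (fun x hx => (hT.differentiableAt (hsb hx)).hasFDerivAt.hasFDerivWithinAt)
    (hT.injOn.mono hsb)]
  refine setIntegral_congr_fun hs fun x hx => ?_
  have hx' := hsb hx
  obtain ⟨S, hS⟩ := hT.conformal x hx'
  have hTx := hT.mapsTo hx'
  have k1 := conformalFactor_pos hx'
  have k2 := conformalFactor_pos hTx
  -- The Jacobian contributes the cube of the ratio and the gradients its square; the remaining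
  -- power turns `λ(T x)` into `λ(x)`.
  have hdet : |(fderiv ℝ T x).det| = (conformalFactor x / conformalFactor (T x)) ^ 3 := by
    have : ((conformalFactor x / conformalFactor (T x)) • (S : E3 →L[ℝ] E3)).det
        = (conformalFactor x / conformalFactor (T x)) ^ 3 * (S : E3 →L[ℝ] E3).det := by
      rw [ContinuousLinearMap.det, ContinuousLinearMap.toLinearMap_smul, LinearMap.det_smul]
      simp [ContinuousLinearMap.det]
    rw [hS.fderiv, this, abs_mul, abs_det_linearIsometryEquiv, mul_one, abs_of_pos (by positivity)]
  simp only [smul_eq_mul]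
  rw [hdet, hT.sum_partialDeriv_comp hx' (differentiableAt_of_contDiffOn hF hTx)
    (differentiableAt_of_contDiffOn hG hTx)]
  field_simp

end IsBallInvolution

/-! ### Weak harmonicity and its invariance under isometries. -/

theorem integrable_of_eq_zero_off_compact {G : E3 → ℝ} {K : Set E3} (hK : IsCompact K)
    (hG : ContinuousOn G K) (h0 : ∀ x ∉ K, G x = 0) : Integrable G := by
  rw [← integrableOn_iff_integrable_of_support_subset (s := K)]
  · exact hG.integrableOn_compact hK
  · intro x hx
    by_contra h
    exact hx (h0 x h)

theorem partialDeriv_eq_zero_of_notMem_tsupport {ψ : E3 → ℝ} {x : E3} (hx : x ∉ tsupport ψ)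
    (i : Fin 3) : partialDeriv i ψ x = 0 := by
  rw [partialDeriv, fderiv_of_notMem_tsupport ℝ hx]
  rfl

/-- Integration by parts against a test function on the ball. -/
theorem integral_ball_test {F : E3 → ℝ} (hF : ContDiffOn ℝ 2 F (ball 0 1)) {ψ : E3 → ℝ}
    (hψ : ContDiff ℝ 1 ψ) (hc : HasCompactSupport ψ) (hs : tsupport ψ ⊆ ball 0 1) :
    ∫ x in ball (0 : E3) 1, conformalFactor x * ∑ i, partialDeriv i F x * partialDeriv i ψ x
      = -∫ x, ψ x *
        ∑ i, partialDeriv i (fun y => conformalFactor y * partialDeriv i F y) x := by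
  have hW := contDiffOn_conformalFactor_mul hF
  set W : Fin 3 → E3 → ℝ := fun i y => conformalFactor y * partialDeriv i F y with hWdef
  have hψ0 : ∀ x ∉ tsupport ψ, ψ x = 0 := fun x hx => image_eq_zero_of_notMem_tsupport hx
  have hψ'0 := fun i => fun x (hx : x ∉ tsupport ψ) =>
    partialDeriv_eq_zero_of_notMem_tsupport hx i
  have cW := fun i => ((hW i).continuousOn).mono hs
  have cW' := fun i => (continuousOn_fderiv_apply (hW i) (EuclideanSpace.single i 1)).mono hs
  have cψ : ContinuousOn ψ (tsupport ψ) := hψ.continuous.continuousOn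
  have cψ' := fun i : Fin 3 => (continuousOn_fderiv_apply hψ.contDiffOn
    (EuclideanSpace.single i 1)).mono hs
  have i1 : ∀ i, Integrable (fun x => partialDeriv i ψ x * W i x) := fun i =>
    integrable_of_eq_zero_off_compact hc ((cψ' i).mul (cW i)) fun x hx => by
      rw [hψ'0 i x hx, zero_mul]
  have i2 : ∀ i, Integrable (fun x => ψ x * partialDeriv i (W i) x) := fun i =>
    integrable_of_eq_zero_off_compact hc (cψ.mul (cW' i)) fun x hx => by
      rw [hψ0 x hx, zero_mul]
  have i3 : ∀ i, Integrable (fun x => ψ x * W i x) := fun i =>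
    integrable_of_eq_zero_off_compact hc (cψ.mul (cW i)) fun x hx => by
      rw [hψ0 x hx, zero_mul]
  have parts : ∀ i, ∫ x, partialDeriv i ψ x * W i x = -∫ x, ψ x * partialDeriv i (W i) x :=
    fun i => by
      have := integral_mul_fderiv_eq_neg_fderiv_mul_of_integrable (μ := volume) (i1 i) (i2 i)
        (i3 i) (fun x _ => hψ.differentiable one_ne_zero x)
        (fun x hx => differentiableAt_of_contDiffOn (hW i) (hs hx))
      simp only [partialDeriv] at this ⊢
      rw [this, neg_neg]
  rw [setIntegral_eq_integral_of_forall_compl_eq_zero fun x hx => by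
    simp [hψ'0 _ x (fun h => hx (hs h))]]
  simp only [Finset.mul_sum]
  rw [integral_finsetSum _ fun i _ => i2 i, ← Finset.sum_neg_distrib,
    ← Finset.sum_congr rfl fun i _ => parts i, ← integral_finsetSum _ fun i _ => i1 i]
  congr 1
  ext x
  exact Finset.sum_congr rfl fun i _ => by simp only [hWdef]; ring

/-- The weak form of harmonicity on the ball. -/
theorem IsBallHarmonic.integral_eq_zero {F : E3 → ℝ} (hF : IsBallHarmonic F) {ψ : E3 → ℝ}
    (hψ : ContDiff ℝ 1 ψ) (hc : HasCompactSupport ψ) (hs : tsupport ψ ⊆ ball 0 1) :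
    ∫ x in ball (0 : E3) 1, conformalFactor x * ∑ i, partialDeriv i F x * partialDeriv i ψ x
      = 0 := by
  rw [integral_ball_test hF.1 hψ hc hs, neg_eq_zero]
  refine integral_eq_zero_of_ae (Eventually.of_forall fun x => ?_)
  by_cases hx : x ∈ tsupport ψ
  · simp [hF.2 x (hs hx)]
  · simp [image_eq_zero_of_notMem_tsupport hx]

/-- The fundamental lemma of the calculus of variations gives the equation almost everywhere,
continuity everywhere. The weak form involves only first derivatives, so invariance under isometries
needs no second order chain rule. -/
theorem isBallHarmonic_of_weak {F : E3 → ℝ} (hF : ContDiffOn ℝ 2 F (ball 0 1))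
    (h : ∀ ψ : E3 → ℝ, ContDiff ℝ 1 ψ → HasCompactSupport ψ → tsupport ψ ⊆ ball 0 1 →
      ∫ x in ball (0 : E3) 1, conformalFactor x * ∑ i, partialDeriv i F x * partialDeriv i ψ x
        = 0) :
    IsBallHarmonic F := by
  refine ⟨hF, ?_⟩
  have hcont : ContinuousOn (fun x => ∑ i, partialDeriv i
      (fun y => conformalFactor y * partialDeriv i F y) x) (ball (0 : E3) 1) :=
    continuousOn_finsetSum _ fun i _ =>
      continuousOn_fderiv_apply (contDiffOn_conformalFactor_mul hF i) _
  have hae := isOpen_ball.ae_eq_zero_of_integral_contDiff_smul_eq_zero (μ := volume)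
    (hcont.locallyIntegrableOn measurableSet_ball) fun ψ hψ hc hs => by
      have h1 : ContDiff ℝ 1 ψ := hψ.of_le (by norm_cast)
      have := integral_ball_test hF h1 hc hs
      rw [h ψ h1 hc hs] at this
      simpa using this.symm
  exact Measure.eqOn_open_of_ae_eq (μ := volume) (g := fun _ => 0)
    ((ae_restrict_iff' measurableSet_ball).2 hae) isOpen_ball hcont continuousOn_const

/-- Harmonicity is preserved by isometries. -/
theorem IsBallInvolution.isBallHarmonic_comp {T : E3 → E3} (hT : IsBallInvolution T) {F : E3 → ℝ}
    (hF : IsBallHarmonic F) : IsBallHarmonic (F ∘ T) := by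
  refine isBallHarmonic_of_weak (hT.contDiffOn_comp le_rfl hF.1) fun ψ hψ hc hs => ?_
  have hF1 : ContDiffOn ℝ 1 F (ball 0 1) := hF.1.of_le (by norm_num)
  set K := T '' tsupport ψ with hK
  have hKc : IsCompact K := hc.isCompact.image_of_continuousOn (hT.contDiffOn.continuousOn.mono hs)
  have hKb : K ⊆ ball 0 1 := (hT.mapsTo.mono_left hs).image_subset
  -- The transported test function. Nothing is known about `T` outside the ball, so it is cut off
  -- there; its support lies in the compact set `K` inside the ball, so the extension by zero stays
  -- `C¹`.
  set φ : E3 → ℝ := (ball (0 : E3) 1).indicator (ψ ∘ T) with hφ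
  have hφ0 : ∀ x ∉ K, φ x = 0 := fun x hx => by
    by_cases hxb : x ∈ ball (0 : E3) 1
    · rw [hφ, indicator_of_mem hxb]
      exact image_eq_zero_of_notMem_tsupport (f := ψ) fun h => hx ⟨T x, h, hT.invol x hxb⟩
    · rw [hφ, indicator_of_notMem hxb]
  have hts : tsupport φ ⊆ K := closure_minimal (fun x hx => by
    by_contra h; exact hx (hφ0 x h)) hKc.isClosed
  have hφc : HasCompactSupport φ := HasCompactSupport.intro hKc hφ0
  have hφd : ContDiff ℝ 1 φ := by
    rw [contDiff_iff_contDiffAt]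
    intro x
    by_cases hx : x ∈ ball (0 : E3) 1
    · have h1 : ContDiffAt ℝ 1 (ψ ∘ T) x :=
        (hT.contDiffOn_comp (by norm_num) hψ.contDiffOn).contDiffAt (isOpen_ball.mem_nhds hx)
      refine h1.congr_of_eventuallyEq ?_
      filter_upwards [isOpen_ball.mem_nhds hx] with y hy using indicator_of_mem hy _
    · have : φ =ᶠ[𝓝 x] fun _ => 0 := by
        filter_upwards [hKc.isClosed.isOpen_compl.mem_nhds fun h => hx (hKb h)] with y hy
          using hφ0 y hy
      exact contDiffAt_const.congr_of_eventuallyEq this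
  have key := hF.integral_eq_zero hφd hφc (hts.trans hKb)
  have himg := hT.image_ball
  rw [← himg, hT.setIntegral_image hF1 hφd.contDiffOn measurableSet_ball Subset.rfl] at key
  rw [← key]
  refine setIntegral_congr_fun measurableSet_ball fun x hx => ?_
  have he : φ ∘ T =ᶠ[𝓝 x] ψ := by
    filter_upwards [isOpen_ball.mem_nhds hx] with y hy
    rw [Function.comp, hφ, indicator_of_mem (hT.mapsTo hy), Function.comp, hT.invol y hy]
  simp only [partialDeriv_congr he]

/-! ### From the Riemannian definitions to the conformal factor. -/

theorem metric_eq (x : E3) :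
    metric x = (conformalFactor x ^ 2) • (1 : Matrix (Fin 3) (Fin 3) ℝ) := by
  rw [metric, conformalFactor, div_pow]
  norm_num

theorem metric_inv_apply {x : E3} (hx : x ∈ ball (0 : E3) 1) (i j : Fin 3) :
    (metric x)⁻¹ i j = (conformalFactor x ^ 2)⁻¹ * (1 : Matrix (Fin 3) (Fin 3) ℝ) i j := by
  have h : conformalFactor x ^ 2 ≠ 0 := (pow_pos (conformalFactor_pos hx) 2).ne'
  have : (metric x)⁻¹ = (conformalFactor x ^ 2)⁻¹ • (1 : Matrix (Fin 3) (Fin 3) ℝ) := by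
    refine Matrix.inv_eq_right_inv ?_
    rw [metric_eq, smul_mul_smul_comm, mul_inv_cancel₀ h, one_smul, mul_one]
  rw [this]
  rfl

theorem volumeDensity_eq {x : E3} (hx : x ∈ ball (0 : E3) 1) :
    volumeDensity x = conformalFactor x ^ 3 := by
  rw [volumeDensity, metric_eq, Matrix.det_smul, Matrix.det_one, mul_one, Fintype.card_fin,
    ← pow_mul, mul_comm, pow_mul, Real.sqrt_sq (pow_pos (conformalFactor_pos hx) 3).le]

theorem sum_metric_inv {x : E3} (hx : x ∈ ball (0 : E3) 1) (i : Fin 3) (v : Fin 3 → ℝ) :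
    ∑ j, (metric x)⁻¹ i j * v j = (conformalFactor x ^ 2)⁻¹ * v i := by
  simp [metric_inv_apply hx, Matrix.one_apply]

/-- In dimension three `√(det g) g⁻¹ = λ³ λ⁻² = λ` times the identity. -/
theorem laplaceBeltrami_eq (F : E3 → ℝ) {x : E3} (hx : x ∈ ball (0 : E3) 1) :
    laplaceBeltrami F x = (conformalFactor x ^ 3)⁻¹ *
      ∑ i, partialDeriv i (fun y => conformalFactor y * partialDeriv i F y) x := by
  rw [laplaceBeltrami, volumeDensity_eq hx]
  congr 1
  refine Finset.sum_congr rfl fun i _ => partialDeriv_congr ?_ i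
  filter_upwards [isOpen_ball.mem_nhds hx] with y hy
  have := (conformalFactor_pos hy).ne'
  rw [sum_metric_inv hy i fun j => partialDeriv j F y, volumeDensity_eq hy]
  field_simp

theorem coe_mem_ball (x : HyperbolicSpace3) : x.1 ∈ ball (0 : E3) 1 := by
  simpa using x.2

theorem isHarmonic_iff (f : HyperbolicSpace3 → ℝ) :
    IsHarmonic f ↔ IsBallHarmonic (coordRep f) := by
  refine and_congr_right fun _ => ⟨fun h x hx => ?_, fun h x => ?_⟩
  · have := h ⟨x, by simpa using hx⟩
    rw [laplaceBeltrami_eq _ hx] at this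
    exact (mul_eq_zero.1 this).resolve_left (inv_ne_zero (pow_pos (conformalFactor_pos hx) 3).ne')
  · rw [laplaceBeltrami_eq _ (coe_mem_ball x), h _ (coe_mem_ball x), mul_zero]

theorem normDifferential_sq (f : HyperbolicSpace3 → ℝ) (x : HyperbolicSpace3) :
    normDifferential f x ^ 2
      = (conformalFactor x.1 ^ 2)⁻¹ * ∑ i, partialDeriv i (coordRep f) x.1 ^ 2 := by
  have h : ∑ i, ∑ j, (metric x.1)⁻¹ i j * partialDeriv i (coordRep f) x.1 *
      partialDeriv j (coordRep f) x.1
      = (conformalFactor x.1 ^ 2)⁻¹ * ∑ i, partialDeriv i (coordRep f) x.1 ^ 2 := by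
    rw [Finset.mul_sum]
    refine Finset.sum_congr rfl fun i _ => ?_
    simp only [mul_assoc]
    rw [sum_metric_inv (coe_mem_ball x) i fun j => partialDeriv i (coordRep f) x.1 *
      partialDeriv j (coordRep f) x.1, pow_two (partialDeriv _ _ _)]
  rw [normDifferential, h, Real.sq_sqrt]
  exact mul_nonneg (inv_nonneg.2 (sq_nonneg _)) (Finset.sum_nonneg fun i _ => sq_nonneg _)

theorem setIntegral_vol {B : Set HyperbolicSpace3} (hB : MeasurableSet B) (G : E3 → ℝ) :
    ∫ x in B, G x.1 ∂vol = ∫ x in Subtype.val '' B, conformalFactor x ^ 3 * G x := by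
  have hball : MeasurableSet {x : E3 | ‖x‖ < 1} := measurableSet_lt (by fun_prop) (by fun_prop)
  have hcf : Measurable fun x : E3 => conformalFactor x := by unfold conformalFactor; fun_prop
  have hm : Measurable fun x : HyperbolicSpace3 => (conformalFactor x.1 ^ 3).toNNReal :=
    ((hcf.comp measurable_subtype_coe).pow_const 3).real_toNNReal
  have hvol : vol = (Measure.comap Subtype.val (volume : Measure E3)).withDensity
      fun x : HyperbolicSpace3 => ((conformalFactor x.1 ^ 3).toNNReal : ENNReal) := by
    unfold vol
    congr 1
    ext x
    rw [volumeDensity_eq (coe_mem_ball x)]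
    rfl
  have hBm : MeasurableSet (Subtype.val '' B : Set E3) :=
    (MeasurableEmbedding.subtype_coe hball).measurableSet_image.2 hB
  rw [hvol, setIntegral_withDensity_eq_setIntegral_smul hm _ hB, ← integral_indicator hB,
    ← integral_indicator hBm]
  have himg : Subtype.val '' B ⊆ {x : E3 | ‖x‖ < 1} := by
    rintro _ ⟨x, -, rfl⟩; exact x.2
  rw [← setIntegral_eq_integral_of_forall_compl_eq_zero (s := {x : E3 | ‖x‖ < 1}) fun x hx => by
    rw [indicator_of_notMem fun h => hx (himg h)],
    ← integral_subtype_comap hball]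
  congr 1
  ext x
  by_cases hx : x ∈ B
  · rw [indicator_of_mem hx, indicator_of_mem (mem_image_of_mem _ hx), NNReal.smul_def,
      Real.coe_toNNReal _ (pow_pos (conformalFactor_pos (coe_mem_ball x)) 3).le, smul_eq_mul]
  · rw [indicator_of_notMem hx, indicator_of_notMem]
    rintro ⟨y, hy, hyx⟩
    exact hx (Subtype.ext hyx ▸ hy)

theorem setIntegral_normDifferential_sq (f : HyperbolicSpace3 → ℝ) {B : Set HyperbolicSpace3}
    (hB : MeasurableSet B) :
    ∫ x in B, normDifferential f x ^ 2 ∂vol = ∫ x in Subtype.val '' B,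
      conformalFactor x * ∑ i, partialDeriv i (coordRep f) x ^ 2 := by
  have hball : MeasurableSet {x : E3 | ‖x‖ < 1} := measurableSet_lt (by fun_prop) (by fun_prop)
  simp only [normDifferential_sq]
  rw [setIntegral_vol hB fun x => (conformalFactor x ^ 2)⁻¹ *
    ∑ i, partialDeriv i (coordRep f) x ^ 2]
  refine setIntegral_congr_fun
    ((MeasurableEmbedding.subtype_coe hball).measurableSet_image.2 hB) ?_
  rintro _ ⟨x, -, rfl⟩
  have := (conformalFactor_pos (coe_mem_ball x)).ne'
  simp only
  field_simp

/-! ### Transport to an arbitrary centre. -/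

theorem tanh_half_mem {r : ℝ} (hr : 0 < r) : Real.tanh (r / 2) ∈ Ioo (0 : ℝ) 1 := by
  have hsh : 0 < Real.sinh (r / 2) := Real.sinh_pos_iff.2 (by linarith)
  exact ⟨by rw [Real.tanh_eq_sinh_div_cosh]; exact div_pos hsh (Real.cosh_pos _),
    Real.tanh_lt_one _⟩

theorem IsBallInvolution.hdist_lt_iff {T : E3 → E3} (hT : IsBallInvolution T)
    {p x : HyperbolicSpace3} (hp : T 0 = p.1) {r : ℝ} (hr : 0 < r) :
    hdist x p < r ↔ ‖T x.1‖ < Real.tanh (r / 2) := by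
  have hx := coe_mem_ball x
  have h0 : (0 : E3) ∈ ball (0 : E3) 1 := by simp
  have hTx := hT.mapsTo hx
  have hd := hT.dist_sq (T x.1) hTx 0 h0
  rw [hT.invol _ hx, hp] at hd
  have p1 := one_sub_norm_sq_pos hx
  have p2 := one_sub_norm_sq_pos (coe_mem_ball p)
  have p3 := one_sub_norm_sq_pos hTx
  set q := ‖x.1 - p.1‖ / √((1 - ‖x.1‖ ^ 2) * (1 - ‖p.1‖ ^ 2)) with hq
  have hq0 : 0 ≤ q := by positivity
  -- Here `q` is `sinh` of half the distance; isometry allows computing it from `T x` and the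
  -- centre.
  have hq2 : q ^ 2 = ‖T x.1‖ ^ 2 / (1 - ‖T x.1‖ ^ 2) := by
    rw [hq, div_pow, Real.sq_sqrt (mul_pos p1 p2).le, hd]
    simp only [sub_zero, norm_zero]
    field_simp
    norm_num
  have hsh : 0 < Real.sinh (r / 2) := Real.sinh_pos_iff.2 (by linarith)
  have hch := Real.cosh_pos (r / 2)
  have hcs := Real.cosh_sq (r / 2)
  have hR := tanh_half_mem hr
  have step1 : hdist x p < r ↔ q < Real.sinh (r / 2) := by
    have h := Real.arsinh_lt_arsinh (x := q) (y := Real.sinh (r / 2))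
    rw [Real.arsinh_sinh] at h
    rw [hdist, ← hq, ← h]
    constructor <;> intro h <;> linarith
  rw [step1, ← sq_lt_sq₀ hq0 hsh.le, ← sq_lt_sq₀ (norm_nonneg _) hR.1.le, hq2,
    Real.tanh_eq_sinh_div_cosh, div_pow, div_lt_iff₀ p3, lt_div_iff₀ (by positivity), hcs]
  constructor <;> intro h <;> linarith

theorem IsBallInvolution.image_hball {T : E3 → E3} (hT : IsBallInvolution T)
    {p : HyperbolicSpace3} (hp : T 0 = p.1) {r : ℝ} (hr : 0 < r) :
    Subtype.val '' hball p r = T '' ball 0 (Real.tanh (r / 2)) := by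
  have hsub := ball_subset_ball (x := (0 : E3)) (tanh_half_mem hr).2.le
  ext x
  constructor
  · rintro ⟨x, hx, rfl⟩
    exact ⟨T x.1, by simpa using (hT.hdist_lt_iff hp hr).1 hx, hT.invol _ (coe_mem_ball x)⟩
  · rintro ⟨y, hy, rfl⟩
    have hTy := hT.mapsTo (hsub hy)
    refine ⟨⟨T y, by simpa using hTy⟩, (hT.hdist_lt_iff hp hr).2 ?_, rfl⟩
    rw [hT.invol y (hsub hy)]
    simpa using hy

theorem measurableSet_hball (p : HyperbolicSpace3) (r : ℝ) : MeasurableSet (hball p r) := by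
  have h : Measurable fun x : HyperbolicSpace3 => hdist x p := by
    unfold hdist
    exact (Real.continuous_arsinh.measurable.comp (by fun_prop)).const_mul 2
  exact h measurableSet_Iio

theorem IsBallInvolution.setIntegral_hball {T : E3 → E3} (hT : IsBallInvolution T)
    {p : HyperbolicSpace3} (hp : T 0 = p.1) {f : HyperbolicSpace3 → ℝ}
    (hf : ContDiffOn ℝ 1 (coordRep f) (ball 0 1)) {r : ℝ} (hr : 0 < r) :
    ∫ x in hball p r, normDifferential f x ^ 2 ∂vol
      = ∫ x in ball (0 : E3) (Real.tanh (r / 2)),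
        conformalFactor x * ∑ i, partialDeriv i (coordRep f ∘ T) x ^ 2 := by
  rw [setIntegral_normDifferential_sq f (measurableSet_hball p r), hT.image_hball hp hr]
  simp only [pow_two (partialDeriv _ _ _)]
  exact hT.setIntegral_image hf hf measurableSet_ball (ball_subset_ball (tanh_half_mem hr).2.le)

/-- The `4` is the square of the conformal factor at the centre, and it is also the factor between
`nu` and `energyConst`. -/
theorem IsBallInvolution.normDifferential_sq {T : E3 → E3} (hT : IsBallInvolution T)
    {p : HyperbolicSpace3} (hp : T 0 = p.1) {f : HyperbolicSpace3 → ℝ}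
    (hf : ContDiffOn ℝ 1 (coordRep f) (ball 0 1)) :
    4 * normDifferential f p ^ 2 = ∑ i, partialDeriv i (coordRep f ∘ T) 0 ^ 2 := by
  have h0 : (0 : E3) ∈ ball (0 : E3) 1 := by simp
  have hd : DifferentiableAt ℝ (coordRep f) (T 0) :=
    differentiableAt_of_contDiffOn hf (hT.mapsTo h0)
  have h := hT.sum_partialDeriv_comp h0 hd hd
  have c0 : conformalFactor (0 : E3) = 2 := by simp [conformalFactor]
  simp only [← pow_two (partialDeriv _ _ _)] at h
  rw [h, HyperbolicSpace3.normDifferential_sq, hp, c0, div_pow]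
  ring

theorem nu_pos {r : ℝ} (hr : 0 < r) : 0 < nu r := by
  rw [nu_eq hr]
  linarith [energyConst_pos (tanh_half_mem hr)]

theorem normDifferential_nonneg (f : HyperbolicSpace3 → ℝ) (x : HyperbolicSpace3) :
    0 ≤ normDifferential f x := Real.sqrt_nonneg _

theorem nu_mul_normDifferential_sq_le {f : HyperbolicSpace3 → ℝ} (hf : IsHarmonic f)
    (p : HyperbolicSpace3) {r : ℝ} (hr : 0 < r) :
    nu r * normDifferential f p ^ 2 ≤ ∫ x in hball p r, normDifferential f x ^ 2 ∂vol := by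
  obtain ⟨T, hT, hp⟩ := exists_isBallInvolution (coe_mem_ball p)
  have hF := (isHarmonic_iff f).1 hf
  have hF1 : ContDiffOn ℝ 1 (coordRep f) (ball 0 1) := hF.1.of_le (by norm_num)
  have h := (hT.isBallHarmonic_comp hF).energy_ge (tanh_half_mem hr)
  rw [← hT.setIntegral_hball hp hF1 hr, ← hT.normDifferential_sq hp hF1] at h
  rw [nu_eq hr]
  linarith

theorem coordRep_eqOn (G : E3 → ℝ) : EqOn (coordRep fun x => G x.1) G (ball 0 1) := fun x hx => by
  have : ‖x‖ < 1 := by simpa using hx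
  simp [coordRep, this]

theorem IsBallHarmonic.congr {F G : E3 → ℝ} (hF : IsBallHarmonic F)
    (h : EqOn G F (ball 0 1)) : IsBallHarmonic G := by
  refine ⟨hF.1.congr h, fun x hx => ?_⟩
  rw [← hF.2 x hx]
  refine Finset.sum_congr rfl fun i _ => partialDeriv_congr ?_ i
  filter_upwards [isOpen_ball.mem_nhds hx] with y hy
  rw [partialDeriv_congr (h.eventuallyEq_of_mem (isOpen_ball.mem_nhds hy))]

theorem exists_extremal (p : HyperbolicSpace3) : ∃ f : HyperbolicSpace3 → ℝ, IsHarmonic f ∧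
    normDifferential f p ≠ 0 ∧ ∀ r : ℝ, 0 < r →
      ∫ x in hball p r, normDifferential f x ^ 2 ∂vol = nu r * normDifferential f p ^ 2 := by
  obtain ⟨T, hT, hp⟩ := exists_isBallInvolution (coe_mem_ball p)
  set e : E3 := EuclideanSpace.single 0 1 with he
  have hH := isBallHarmonic_extremal e
  -- As `T` is an involution, pulling this function back by `T` returns the extremal function at the
  -- centre; one choice of `T` serves every `r`.
  set f : HyperbolicSpace3 → ℝ := fun x => (extremal e ∘ T) x.1 with hf
  have hfe : EqOn (coordRep f) (extremal e ∘ T) (ball 0 1) := coordRep_eqOn _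
  have hF : IsBallHarmonic (coordRep f) := (hT.isBallHarmonic_comp hH).congr hfe
  have hF1 : ContDiffOn ℝ 1 (coordRep f) (ball 0 1) := hF.1.of_le (by norm_num)
  have hcomp : EqOn (coordRep f ∘ T) (extremal e) (ball 0 1) := fun x hx => by
    rw [Function.comp, hfe (hT.mapsTo hx), Function.comp, hT.invol x hx]
  have hpd : ∀ x ∈ ball (0 : E3) 1, ∀ i,
      partialDeriv i (coordRep f ∘ T) x = partialDeriv i (extremal e) x := fun x hx i =>
    partialDeriv_congr (hcomp.eventuallyEq_of_mem (isOpen_ball.mem_nhds hx)) i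
  have hnorm : 4 * normDifferential f p ^ 2 = 16 / 9 := by
    rw [hT.normDifferential_sq hp hF1]
    simp only [hpd 0 (by simp), partialDeriv_extremal e (x := 0) (by simp)]
    simp [profile_zero, he]
    norm_num
  refine ⟨f, (isHarmonic_iff f).2 hF, fun h => by rw [h] at hnorm; norm_num at hnorm,
    fun r hr => ?_⟩
  have hR := tanh_half_mem hr
  have henergy := energy_extremal e hR
  rw [hT.setIntegral_hball hp hF1 hr, nu_eq hr]
  rw [setIntegral_congr_fun (g := fun x => conformalFactor x *
    ∑ i, partialDeriv i (extremal e) x ^ 2) measurableSet_ball fun x hx => by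
      simp only [hpd x (ball_subset_ball hR.2.le hx)], henergy]
  have hn : ‖e‖ = 1 := by simp [he]
  rw [hn]
  linear_combination (-energyConst (Real.tanh (r / 2))) * hnorm

end HyperbolicSpace3

theorem lemma4p2 :
    (∀ (f : HyperbolicSpace3 → ℝ), HyperbolicSpace3.IsHarmonic f →
      ∀ (p : HyperbolicSpace3) (r : ℝ), 0 < r →
        HyperbolicSpace3.normDifferential f p ≤
          1 / √(HyperbolicSpace3.nu r) *
            HyperbolicSpace3.l2NormDifferential f (HyperbolicSpace3.hball p r)) ∧
    (∀ p : HyperbolicSpace3, ∃ f : HyperbolicSpace3 → ℝ, HyperbolicSpace3.IsHarmonic f ∧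
      HyperbolicSpace3.normDifferential f p ≠ 0 ∧
      ∀ r : ℝ, 0 < r →
        HyperbolicSpace3.normDifferential f p =
          1 / √(HyperbolicSpace3.nu r) *
            HyperbolicSpace3.l2NormDifferential f (HyperbolicSpace3.hball p r)) := by
  refine ⟨fun f hf p r hr => ?_, fun p => ?_⟩
  · have hnu := HyperbolicSpace3.nu_pos hr
    rw [one_div_mul_eq_div, le_div_iff₀ (Real.sqrt_pos.2 hnu),
      HyperbolicSpace3.l2NormDifferential]
    refine Real.le_sqrt_of_sq_le ?_
    rw [mul_pow, Real.sq_sqrt hnu.le, mul_comm]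
    exact HyperbolicSpace3.nu_mul_normDifferential_sq_le hf p hr
  · obtain ⟨f, hf, h0, h⟩ := HyperbolicSpace3.exists_extremal p
    refine ⟨f, hf, h0, fun r hr => ?_⟩
    have hnu := HyperbolicSpace3.nu_pos hr
    rw [HyperbolicSpace3.l2NormDifferential, h r hr, Real.sqrt_mul hnu.le,
      Real.sqrt_sq (HyperbolicSpace3.normDifferential_nonneg f p), ← mul_assoc,
      one_div_mul_cancel (Real.sqrt_pos.2 hnu).ne', one_mul]
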